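/- Let $c>0$ and let $\alpha,\beta\in C^3((0,\infty))$ be real-valued. On $\mathbb{R}\times(\mathbb{R}^3\setminus\{0\})$ consider the spherically symmetric static Lorentzian metric $$g=-e^{2\alpha(r)}c^2\,dt^2+e^{2\beta(r)}\,dr^2+r^2(d\theta^2+\sin^2\theta\,d\phi^2),$$ where $r=|x|$ for $x\in\mathbb{R}^3$, with volume element $d\operatorname{vol}_g=c\,e^{\alpha+\beta}\,dt\,dx$ and Einstein tensor $G^\mu{}_\nu=R^\mu{}_\nu-\tfrac12R\,\delta^\mu{}_\nu$. The components $G^t{}_t$, $G^r{}_r$, $G^\theta{}_\theta$ in the coordinates $(t,r,\theta,\phi)$ are functions of $r$ alone. We say that the *weak Bianchi identity* holds if for every smooth compactly supported vector field $\psi$ on $\mathbb{R}^4$ $$\int_{\mathbb{R}^4}G^\mu{}_\nu\,\nabla_\mu\psi^\nu\,d\operatorname{vol}_g=0.$$ Here the integrand may be singular on the axis $\{r=0\}$, and the integral is understood as the limit, as $\varepsilon\downarrow0$, of the integrals over $\Omega_\varepsilon=\{(t,x)\in\mathbb{R}^4:|x|\ge\varepsilon\}$, each of which is required to converge absolutely;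 moreover, whenever the integrand is Lebesgue integrable on $\mathbb{R}^4$, its Lebesgue integral over $\mathbb{R}^4$ is required to vanish. 1. Suppose that, as $r\downarrow0$, $$r^3\big(|G^t{}_t|+|G^r{}_r|+|G^\theta{}_\theta|\big)e^{\alpha+\beta}=O(r^\gamma)\quad\text{for some }\gamma>0,\tag{1}$$ $$\lim_{\varepsilon\downarrow0}\varepsilon^3\,G^r{}_r(\varepsilon)\,\|e^{\alpha+\beta}\|_{L^\infty((0,\varepsilon])}=0.\tag{2}$$ Then the weak Bianchi identity holds. (In (2) the norm may be $+\infty$; the convention is $0\cdot\infty=0$.) 2. For each $\gamma>0$, the bound in (1) holds with exponent $\gamma$ if and only if, as $r\downarrow0$, $$r e^{\alpha-\beta}\,(1-e^{2\beta}-2r\beta')=O(r^\gamma),\tag{3}$$ $$r e^{\alpha-\beta}\,(1-e^{2\beta}+2r\alpha')=O(r^\gamma),\tag{4}$$ $$r^2e^{\alpha-\beta}\,\big[(1+r\alpha')(\alpha'-\beta')+r\alpha''\big]=O(r^\gamma).\tag{5}$$ In particular, if (3)–(5) hold for some $\gamma>0$ and (2) holds, then the weak Bianchi identity holds. 3. If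 (4) holds for some $\gamma>0$ and $\alpha+\beta$ is decreasing as $r\downarrow0$ (that is, $r\mapsto\alpha(r)+\beta(r)$ is nondecreasing on $(0,\delta]$ for some $\delta>0$), then (2) holds. -/

import Mathlib

open Set Filter Topology MeasureTheory

noncomputable section

namespace StaticBianchi

/-- Coordinate space `ℝ⁴`, used both for Cartesian coordinates `(t, x¹, x², x³)` and for
spherical coordinates `(t, r, θ, φ)`. -/
abbrev Coord : Type := Fin 4 → ℝ

/-- The components `g_{μν}` of a metric in a coordinate system. -/
abbrev MetricField : Type := Coord → Matrix (Fin 4) (Fin 4) ℝ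

/-- Partial derivative `∂_μ f`. -/
def pd (μ : Fin 4) (f : Coord → ℝ) (x : Coord) : ℝ := fderiv ℝ f x (Pi.single μ 1)

/-- Christoffel symbols `Γ^ρ_{μν}` of the Levi-Civita connection. -/
def christoffel (g : MetricField) (ρ μ ν : Fin 4) (x : Coord) : ℝ :=
  (1 / 2) * ∑ σ, (g x)⁻¹ ρ σ *
    (pd μ (fun y => g y ν σ) x + pd ν (fun y => g y μ σ) x - pd σ (fun y => g y μ ν) x)

/-- Riemann tensor `R^ρ_{σμν}`. -/
def riemann (g : MetricField) (ρ σ μ ν : Fin 4) (x : Coord) : ℝ :=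
  pd μ (christoffel g ρ ν σ) x - pd ν (christoffel g ρ μ σ) x
    + ∑ κ, (christoffel g ρ μ κ x * christoffel g κ ν σ x
      - christoffel g ρ ν κ x * christoffel g κ μ σ x)

/-- Ricci tensor `R_{μν} = R^ρ_{μρν}`. -/
def ricci (g : MetricField) (μ ν : Fin 4) (x : Coord) : ℝ := ∑ ρ, riemann g ρ μ ρ ν x

/-- Ricci tensor with its first index raised, `R^μ_ν = g^{μκ} R_{κν}`. -/
def ricciMixed (g : MetricField) (μ ν : Fin 4) (x : Coord) : ℝ :=
  ∑ κ, (g x)⁻¹ μ κ * ricci g κ ν x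

/-- Scalar curvature `R = R^μ_μ`. -/
def scalarCurvature (g : MetricField) (x : Coord) : ℝ := ∑ μ, ricciMixed g μ μ x

/-- The `1`-`1` Einstein tensor `G^μ_ν = R^μ_ν - (1/2) R δ^μ_ν`. -/
def einstein (g : MetricField) (μ ν : Fin 4) (x : Coord) : ℝ :=
  ricciMixed g μ ν x - (1 / 2) * scalarCurvature g x * (1 : Matrix (Fin 4) (Fin 4) ℝ) μ ν

/-- Covariant derivative `∇_μ ψ^ν` of a vector field. -/
def covDeriv (g : MetricField) (ψ : Coord → Coord) (μ ν : Fin 4) (x : Coord) : ℝ :=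
  pd μ (fun y => ψ y ν) x + ∑ κ, christoffel g ν μ κ x * ψ x κ

/-- Density of the metric volume: `d vol_g = √|det g| dx⁰ dx¹ dx² dx³`. -/
def volDensity (g : MetricField) (x : Coord) : ℝ := Real.sqrt |(g x).det|

/-- The line element
`-e^{2α(r)} c² dt² + e^{2β(r)} dr² + r² (dθ² + sin² θ dφ²)` in the coordinates `(t, r, θ, φ)`. -/
def sphericalMetric (c : ℝ) (α β : ℝ → ℝ) : MetricField := fun y =>
  Matrix.diagonal ![-(c ^ 2 * Real.exp (2 * α (y 1))), Real.exp (2 * β (y 1)),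
    (y 1) ^ 2, (y 1) ^ 2 * Real.sin (y 2) ^ 2]

/-- Euclidean distance of `(t, x¹, x², x³)` from the time axis. -/
def radius (x : Coord) : ℝ := Real.sqrt (x 1 ^ 2 + x 2 ^ 2 + x 3 ^ 2)

/-- Components of the one-form `dr = (x¹ dx¹ + x² dx² + x³ dx³) / r` in Cartesian coordinates. -/
def radialForm (x : Coord) : Coord :=
  ![0, x 1 / radius x, x 2 / radius x, x 3 / radius x]

/-- The same line element in the Cartesian coordinates `(t, x¹, x², x³)`. Since
`r² (dθ² + sin² θ dφ²) = |dx|² - dr²`, it is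
`-e^{2α(r)} c² dt² + |dx|² + (e^{2β(r)} - 1) dr²`. Only its values at `r > 0` matter. -/
def cartesianMetric (c : ℝ) (α β : ℝ → ℝ) : MetricField := fun x =>
  Matrix.diagonal ![-(c ^ 2 * Real.exp (2 * α (radius x))), 1, 1, 1]
    + (Real.exp (2 * β (radius x)) - 1) • Matrix.vecMulVec (radialForm x) (radialForm x)

/-- The component `G^μ_ν` in the spherical coordinates `(t, r, θ, φ)`, as a function of `r`.
The diagonal components of the metrics above depend on `r` alone, so they are read off at
`t = 0`, `θ = π / 2`, `φ = 0`. -/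
def sphericalEinstein (c : ℝ) (α β : ℝ → ℝ) (μ ν : Fin 4) (r : ℝ) : ℝ :=
  einstein (sphericalMetric c α β) μ ν ![0, r, Real.pi / 2, 0]

/-- The scalar `G^μ_ν ∇_μ ψ^ν` times the volume density, in Cartesian coordinates. -/
def bianchiIntegrand (c : ℝ) (α β : ℝ → ℝ) (ψ : Coord → Coord) (x : Coord) : ℝ :=
  (∑ μ, ∑ ν, einstein (cartesianMetric c α β) μ ν x * covDeriv (cartesianMetric c α β) ψ μ ν x)
    * volDensity (cartesianMetric c α β) x

/-- The complement `Ω_ε` in `ℝ⁴` of the cylinder of radius `ε` around the time axis. -/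
def outerRegion (ε : ℝ) : Set Coord := {x | ε ≤ radius x}

/-- The twice-contracted second Bianchi identity holds weakly on `ℝ⁴`: for every test vector
field `ψ`, `∫ G^μ_ν ∇_μ ψ^ν d vol_g = 0`. The integrand is defined off the time axis, where it
may be singular, and the integral is the limit as `ε ↓ 0` of the (absolutely convergent)
integrals over `Ω_ε`; where it exists as a Lebesgue integral over `ℝ⁴`, it vanishes as such. -/
def WeakBianchi (c : ℝ) (α β : ℝ → ℝ) : Prop :=
  ∀ ψ : Coord → Coord, ContDiff ℝ (⊤ : ℕ∞) ψ → HasCompactSupport ψ →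
    (∀ ε > 0, IntegrableOn (bianchiIntegrand c α β ψ) (outerRegion ε)) ∧
    Tendsto (fun ε => ∫ x in outerRegion ε, bianchiIntegrand c α β ψ x) (𝓝[>] 0) (𝓝 0) ∧
    (Integrable (bianchiIntegrand c α β ψ) → ∫ x, bianchiIntegrand c α β ψ x = 0)

/-- `r³ (|G^t_t| + |G^r_r| + |G^θ_θ|) e^{α+β} = O(r^γ)` as `r ↓ 0`. -/
def EinsteinDecay (c : ℝ) (α β : ℝ → ℝ) (γ : ℝ) : Prop :=
  (fun r : ℝ => r ^ 3 * (|sphericalEinstein c α β 0 0 r| + |sphericalEinstein c α β 1 1 r|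
    + |sphericalEinstein c α β 2 2 r|) * Real.exp (α r + β r)) =O[𝓝[>] 0] (fun r : ℝ => r ^ γ)

/-- `ε³ G^r_r(ε) ‖e^{α+β}‖_{L^∞((0,ε])} → 0` as `ε ↓ 0`, stated for absolute values because the
norm is an extended real (with `0 · ∞ = 0`). -/
def RadialLimit (c : ℝ) (α β : ℝ → ℝ) : Prop :=
  Tendsto (fun ε : ℝ => ENNReal.ofReal |ε ^ 3 * sphericalEinstein c α β 1 1 ε| *
    eLpNorm (fun r => Real.exp (α r + β r)) ⊤ (volume.restrict (Ioc 0 ε))) (𝓝[>] 0) (𝓝 0)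

/-- `r e^{α-β} (1 - e^{2β} - 2 r β') = O(r^γ)` as `r ↓ 0`. -/
def DecayTT (α β : ℝ → ℝ) (γ : ℝ) : Prop :=
  (fun r : ℝ => r * Real.exp (α r - β r) * (1 - Real.exp (2 * β r) - 2 * r * deriv β r))
    =O[𝓝[>] 0] (fun r : ℝ => r ^ γ)

/-- `r e^{α-β} (1 - e^{2β} + 2 r α') = O(r^γ)` as `r ↓ 0`. -/
def DecayRR (α β : ℝ → ℝ) (γ : ℝ) : Prop :=
  (fun r : ℝ => r * Real.exp (α r - β r) * (1 - Real.exp (2 * β r) + 2 * r * deriv α r))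
    =O[𝓝[>] 0] (fun r : ℝ => r ^ γ)

/-- `r² e^{α-β} [(1 + r α') (α' - β') + r α''] = O(r^γ)` as `r ↓ 0`. -/
def DecayThetaTheta (α β : ℝ → ℝ) (γ : ℝ) : Prop :=
  (fun r : ℝ => r ^ 2 * Real.exp (α r - β r) *
    ((1 + r * deriv α r) * (deriv α r - deriv β r) + r * deriv (deriv α) r))
    =O[𝓝[>] 0] (fun r : ℝ => r ^ γ)

end StaticBianchi

end

/-! Off the axis the twice-contracted Bianchi identity holds classically, so the integrand is the
divergence of the vector density `flux` whose components are `√|g| G^μ_ν ψ^ν`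
(`bianchiIntegrand_eq`). The integral over `Ω_ε` is therefore a boundary flux through the cylinder
`r = ε`. Since `x` is an eigenvector of the spatial part of the Einstein tensor, this flux is `c
e^{α+β} G^r_r(ε)` times the integral of `x · ψ / r` over the cylinder (up to sign).

By reflection in the axis the constant part of `ψ` cancels against the odd function `x`. The
Lipschitz remainder gains one power of `ε`, which together with the area `O(ε²)` bounds the flux by
`ε³ |G^r_r(ε)| e^{α(ε)+β(ε)} = O(ε^γ)`. This is `tendsto_integral_divergence_flux`, which uses
smooth radial cutoffs on thin shells in place of surface integrals; the key estimate is
`abs_integral_shell_le`.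

The curvature is computed twice. In Cartesian coordinates every tensor involved is a combination of
`dt ⊗ dt`, `δ_ij` and `x_i x_j`, which reduces `einstein_cartesianMetric` to scalar identities. In
spherical coordinates `sphericalEinstein_eq` gives the components that enter the decay hypotheses.
Both yield `einsteinTT`, `einsteinRR` and `einsteinAngular`; multiplying these by `r³ e^{α+β}` gives
the conditions on `α` and `β`.

For monotone `α + β` the supremum of `e^{α+β}` on `(0, ε]` is at most its value at `ε`, so the
radial limit condition follows from the decay of `G^r_r`. -/

noncomputable section

namespace StaticBianchi

/-! ### Calculus of coordinate partial derivatives -/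

/-- `f` is differentiable at `x` with partial derivatives `v`. -/
def HasPartials (f : Coord → ℝ) (v : Fin 4 → ℝ) (x : Coord) : Prop :=
  DifferentiableAt ℝ f x ∧ ∀ μ, pd μ f x = v μ

namespace HasPartials

variable {f g : Coord → ℝ} {v w : Fin 4 → ℝ} {x : Coord}

theorem const (a : ℝ) (x : Coord) : HasPartials (fun _ => a) (fun _ => 0) x :=
  ⟨differentiableAt_const a, fun μ => by simp [pd]⟩

theorem coord (i : Fin 4) (x : Coord) :
    HasPartials (fun y => y i) (fun μ => if μ = i then 1 else 0) x := by
  refine ⟨by fun_prop, fun μ => ?_⟩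
  have h : HasFDerivAt (fun y : Coord => y i)
      (ContinuousLinearMap.proj (R := ℝ) (φ := fun _ : Fin 4 => ℝ) i) x :=
    (ContinuousLinearMap.proj (R := ℝ) (φ := fun _ : Fin 4 => ℝ) i).hasFDerivAt
  rw [pd, h.fderiv]
  simp [Pi.single_apply, eq_comm]

theorem add (hf : HasPartials f v x) (hg : HasPartials g w x) :
    HasPartials (fun y => f y + g y) (fun μ => v μ + w μ) x := by
  refine ⟨hf.1.add hg.1, fun μ => ?_⟩
  beta_reduce
  rw [← hf.2, ← hg.2, pd, fderiv_fun_add hf.1 hg.1]; rfl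

theorem mul (hf : HasPartials f v x) (hg : HasPartials g w x) :
    HasPartials (fun y => f y * g y) (fun μ => v μ * g x + f x * w μ) x := by
  refine ⟨hf.1.mul hg.1, fun μ => ?_⟩
  beta_reduce
  rw [← hf.2, ← hg.2, pd, fderiv_fun_mul hf.1 hg.1]
  simp [pd]; ring

theorem comp {h : ℝ → ℝ} {h' : ℝ} (hh : HasDerivAt h h' (f x)) (hf : HasPartials f v x) :
    HasPartials (fun y => h (f y)) (fun μ => h' * v μ) x := by
  have := hh.hasFDerivAt.comp x hf.1.hasFDerivAt
  refine ⟨this.differentiableAt, fun μ => ?_⟩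
  beta_reduce
  rw [← hf.2, pd]
  change fderiv ℝ (h ∘ f) x _ = _
  rw [this.fderiv]
  simp [pd, mul_comm]

theorem congr (hf : HasPartials f v x) (h : g =ᶠ[𝓝 x] f) (hv : ∀ μ, v μ = w μ) :
    HasPartials g w x := by
  refine ⟨hf.1.congr_of_eventuallyEq h, fun μ => ?_⟩
  rw [← hv, ← hf.2, pd, h.fderiv_eq, pd]

theorem congr_partials (hf : HasPartials f v x) (hv : ∀ μ, v μ = w μ) : HasPartials f w x :=
  hf.congr .rfl hv

theorem neg (hf : HasPartials f v x) : HasPartials (fun y => -f y) (fun μ => -v μ) x :=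
  ((const (-1) x).mul hf).congr (.of_forall fun y => by ring) fun μ => by ring

end HasPartials

/-! ### Radial functions and the basic Cartesian tensors -/

theorem continuous_radius : Continuous radius := by
  unfold radius; fun_prop

theorem radius_nonneg (x : Coord) : 0 ≤ radius x := Real.sqrt_nonneg _

theorem radius_sq (x : Coord) : radius x ^ 2 = x 1 ^ 2 + x 2 ^ 2 + x 3 ^ 2 :=
  Real.sq_sqrt (by positivity)

theorem isOpen_radius_pos : IsOpen {x : Coord | 0 < radius x} :=
  isOpen_lt continuous_const continuous_radius

/-- The spatial part `(0, x¹, x², x³)` of a point. -/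
def spatial (x : Coord) : Coord := ![0, x 1, x 2, x 3]

/-- The components `δ^t_μ` of the one-form `dt`. -/
def timeDelta : Fin 4 → ℝ := ![1, 0, 0, 0]

/-- The Kronecker symbol of the spatial indices. -/
def spaceDelta (μ ν : Fin 4) : ℝ := if μ = ν ∧ μ ≠ 0 then 1 else 0

theorem HasPartials.spatial (i : Fin 4) (x : Coord) :
    HasPartials (fun y => spatial y i) (fun μ => spaceDelta μ i) x := by
  fin_cases i
  · refine (HasPartials.const 0 x).congr (.of_forall fun y => rfl) fun μ => ?_
    simp only [spaceDelta]; fin_cases μ <;> simp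
  · refine (HasPartials.coord 1 x).congr (.of_forall fun y => rfl) fun μ => ?_
    simp only [spaceDelta]; fin_cases μ <;> simp
  · refine (HasPartials.coord 2 x).congr (.of_forall fun y => rfl) fun μ => ?_
    simp only [spaceDelta]; fin_cases μ <;> simp
  · refine (HasPartials.coord 3 x).congr (.of_forall fun y => rfl) fun μ => ?_
    simp only [spaceDelta]; fin_cases μ <;> simp

/-- Partial derivatives of a radial function. -/
theorem HasPartials.radial {h : ℝ → ℝ} {h' : ℝ} {x : Coord} (hx : 0 < radius x)
    (hh : HasDerivAt h h' (radius x)) :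
    HasPartials (fun y => h (radius y)) (fun μ => h' / radius x * StaticBianchi.spatial x μ) x := by
  have h2 := radius_sq x
  have hq : 0 < x 1 ^ 2 + x 2 ^ 2 + x 3 ^ 2 := by rw [← h2]; positivity
  have hc := fun i => HasPartials.coord i x
  have hs := (((hc 1).mul (hc 1)).add ((hc 2).mul (hc 2))).add ((hc 3).mul (hc 3))
  have hd : HasDerivAt Real.sqrt (1 / (2 * radius x)) (x 1 * x 1 + x 2 * x 2 + x 3 * x 3) := by
    have : x 1 * x 1 + x 2 * x 2 + x 3 * x 3 = x 1 ^ 2 + x 2 ^ 2 + x 3 ^ 2 := by ring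
    rw [this]
    exact Real.hasDerivAt_sqrt hq.ne'
  have hr := HasPartials.comp hd hs
  have hr' : HasPartials radius (fun μ => StaticBianchi.spatial x μ / radius x) x := by
    refine hr.congr (.of_forall fun y => ?_) fun μ => ?_
    · simp only [radius]; congr 1; ring
    · fin_cases μ <;> simp [StaticBianchi.spatial] <;> field_simp <;> ring
  exact (HasPartials.comp hh hr').congr_partials fun μ => by ring

/-! ### Algebra of static spherically symmetric tensors -/

/-- The coefficient of `x^ρ (δ_μν)` in the spatial Christoffel symbols. -/
def coeffP (β : ℝ → ℝ) (r : ℝ) : ℝ := (1 - Real.exp (-(2 * β r))) / r ^ 2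

/-- The coefficient of `x^ρ x_μ x_ν` in the spatial Christoffel symbols. -/
def coeffQ (β : ℝ → ℝ) (r : ℝ) : ℝ := deriv β r / r ^ 3 - (1 - Real.exp (-(2 * β r))) / r ^ 4

/-- The coefficient of `x_i` in `Γ^t_{ti}`. -/
def coeffU (α : ℝ → ℝ) (r : ℝ) : ℝ := deriv α r / r

/-- The coefficient of `x^i` in `Γ^i_{tt}`. -/
def coeffV (c : ℝ) (α β : ℝ → ℝ) (r : ℝ) : ℝ :=
  c ^ 2 * Real.exp (2 * α r) * Real.exp (-(2 * β r)) * deriv α r / r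

theorem spaceDelta_comm (μ ν : Fin 4) : spaceDelta μ ν = spaceDelta ν μ := by
  unfold spaceDelta; grind

theorem sum_spatial_mul_spatial (x : Coord) : ∑ σ, spatial x σ * spatial x σ = radius x ^ 2 := by
  simp [Fin.sum_univ_four, spatial, radius_sq]; ring

theorem sum_spatial_mul_timeDelta (x : Coord) : ∑ σ, spatial x σ * timeDelta σ = 0 := by
  simp [Fin.sum_univ_four, spatial, timeDelta]

theorem sum_timeDelta_mul_timeDelta : ∑ σ, timeDelta σ * timeDelta σ = 1 := by
  simp [Fin.sum_univ_four, timeDelta]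

theorem sum_spaceDelta_mul_spatial (x : Coord) (ρ : Fin 4) :
    ∑ σ, spaceDelta ρ σ * spatial x σ = spatial x ρ := by
  fin_cases ρ <;> simp [spaceDelta, spatial]

theorem sum_spaceDelta_mul_timeDelta (ρ : Fin 4) : ∑ σ, spaceDelta ρ σ * timeDelta σ = 0 := by
  fin_cases ρ <;> simp [spaceDelta, timeDelta]

theorem sum_spaceDelta_mul_spaceDelta (μ ν : Fin 4) :
    ∑ σ, spaceDelta μ σ * spaceDelta σ ν = spaceDelta μ ν := by
  simp only [Fin.sum_univ_four]
  fin_cases μ <;> fin_cases ν <;> simp [spaceDelta]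

/-- The static spherically symmetric tensor
`a δ^t_μ δ^t_ν + b δ_ij + p x_i x_j`. -/
def frameTensor (a b p : ℝ) (x : Coord) (μ ν : Fin 4) : ℝ :=
  a * (timeDelta μ * timeDelta ν) + b * spaceDelta μ ν + p * (spatial x μ * spatial x ν)

/-- The family is closed under composition because `dt` is orthogonal to `x`, the spatial Kronecker
symbol is a projection fixing `x`, and `x · x = r²`. Contractions thus become arithmetic in three
scalars. -/
theorem sum_frameTensor_mul (a b p a' b' p' : ℝ) (x : Coord) (μ ν : Fin 4) :
    ∑ κ, frameTensor a b p x μ κ * frameTensor a' b' p' x κ ν =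
      frameTensor (a * a') (b * b') (b * p' + p * b' + p * p' * radius x ^ 2) x μ ν := by
  have : ∀ κ, frameTensor a b p x μ κ * frameTensor a' b' p' x κ ν =
      a * a' * timeDelta μ * timeDelta ν * (timeDelta κ * timeDelta κ)
      + p * p' * spatial x μ * spatial x ν * (spatial x κ * spatial x κ)
      + (a * p' * timeDelta μ * spatial x ν + p * a' * spatial x μ * timeDelta ν)
        * (spatial x κ * timeDelta κ)
      + a * b' * timeDelta μ * (spaceDelta ν κ * timeDelta κ)
      + b * a' * timeDelta ν * (spaceDelta μ κ * timeDelta κ)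
      + p * b' * spatial x μ * (spaceDelta ν κ * spatial x κ)
      + b * p' * spatial x ν * (spaceDelta μ κ * spatial x κ)
      + b * b' * (spaceDelta μ κ * spaceDelta κ ν) := fun κ => by
    unfold frameTensor
    rw [spaceDelta_comm ν κ]; ring
  simp only [this, Finset.sum_add_distrib, ← Finset.mul_sum, sum_spatial_mul_spatial,
    sum_spatial_mul_timeDelta, sum_timeDelta_mul_timeDelta, sum_spaceDelta_mul_spatial,
    sum_spaceDelta_mul_timeDelta, sum_spaceDelta_mul_spaceDelta]
  unfold frameTensor
  ring

theorem frameTensor_trace (a b p : ℝ) (x : Coord) :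
    ∑ μ, frameTensor a b p x μ μ = a + 3 * b + p * radius x ^ 2 := by
  simp [Fin.sum_univ_four, frameTensor, timeDelta, spaceDelta, spatial, radius_sq]
  ring

theorem one_eq_frameTensor (x : Coord) (μ ν : Fin 4) :
    (1 : Matrix (Fin 4) (Fin 4) ℝ) μ ν = frameTensor 1 1 0 x μ ν := by
  fin_cases μ <;> fin_cases ν <;> simp [frameTensor, timeDelta, spaceDelta]

/-! ### Metric and Christoffel symbols in Cartesian coordinates -/

theorem cartesianMetric_apply (c : ℝ) (α β : ℝ → ℝ) (x : Coord) (μ ν : Fin 4) :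
    cartesianMetric c α β x μ ν = frameTensor (-(c ^ 2 * Real.exp (2 * α (radius x)))) 1
      ((Real.exp (2 * β (radius x)) - 1) / radius x ^ 2) x μ ν := by
  fin_cases μ <;> fin_cases ν <;>
    simp [cartesianMetric, radialForm, spatial, timeDelta, spaceDelta, frameTensor] <;> ring

theorem cartesianMetric_inv {c : ℝ} (hc : 0 < c) (α β : ℝ → ℝ) {x : Coord} (hx : 0 < radius x)
    (μ ν : Fin 4) :
    (cartesianMetric c α β x)⁻¹ μ ν =
      frameTensor (-(1 / (c ^ 2 * Real.exp (2 * α (radius x))))) 1 (-coeffP β (radius x)) x μ ν := by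
  suffices h : (cartesianMetric c α β x)⁻¹ = Matrix.of (frameTensor
      (-(1 / (c ^ 2 * Real.exp (2 * α (radius x))))) 1 (-coeffP β (radius x)) x) by rw [h]; rfl
  apply Matrix.inv_eq_right_inv
  ext μ ν
  simp only [Matrix.mul_apply, cartesianMetric_apply, Matrix.of_apply, sum_frameTensor_mul]
  rw [one_eq_frameTensor x]
  simp only [coeffP, Real.exp_neg]
  congr 1
  · field_simp
  · ring
  · field_simp
    ring

theorem HasPartials.cartesianMetric {c : ℝ} {α β : ℝ → ℝ} {x : Coord} (hx : 0 < radius x)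
    (hα : DifferentiableAt ℝ α (radius x)) (hβ : DifferentiableAt ℝ β (radius x)) (μ ν : Fin 4) :
    HasPartials (fun y => StaticBianchi.cartesianMetric c α β y μ ν) (fun κ =>
      -(c ^ 2 * Real.exp (2 * α (radius x))) * 2 * deriv α (radius x) / radius x
          * StaticBianchi.spatial x κ * (timeDelta μ * timeDelta ν)
      + (2 * deriv β (radius x) * Real.exp (2 * β (radius x)) / radius x ^ 3
          - 2 * (Real.exp (2 * β (radius x)) - 1) / radius x ^ 4)
          * StaticBianchi.spatial x κ * (StaticBianchi.spatial x μ * StaticBianchi.spatial x ν)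
      + (Real.exp (2 * β (radius x)) - 1) / radius x ^ 2
          * (spaceDelta κ μ * StaticBianchi.spatial x ν
            + StaticBianchi.spatial x μ * spaceDelta κ ν)) x := by
  have h1 : HasDerivAt (fun r => -(c ^ 2 * Real.exp (2 * α r)))
      (-(c ^ 2 * (Real.exp (2 * α (radius x)) * (2 * deriv α (radius x))))) (radius x) :=
    ((((hα.hasDerivAt).const_mul 2).exp).const_mul (c ^ 2)).neg
  have h2 : HasDerivAt (fun r => (Real.exp (2 * β r) - 1) / r ^ 2)
      (((Real.exp (2 * β (radius x)) * (2 * deriv β (radius x))) * radius x ^ 2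
        - (Real.exp (2 * β (radius x)) - 1) * (2 * radius x)) / (radius x ^ 2) ^ 2) (radius x) :=
    ((((hβ.hasDerivAt).const_mul 2).exp).sub_const 1).div
      (by simpa using hasDerivAt_pow 2 (radius x)) (by positivity)
  have h := ((((HasPartials.radial hx h1).mul
    (HasPartials.const (timeDelta μ * timeDelta ν) x)).add
      (HasPartials.const (1 * spaceDelta μ ν) x)).add
    ((HasPartials.radial hx h2).mul
      ((HasPartials.spatial μ x).mul (HasPartials.spatial ν x))))
  refine h.congr (.of_forall fun y => cartesianMetric_apply c α β y μ ν) fun κ => ?_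
  field_simp
  ring

/-- The Christoffel symbols of a metric of the form considered here in Cartesian coordinates. -/
def christoffelForm (P Q U V : ℝ → ℝ) (ρ μ ν : Fin 4) (x : Coord) : ℝ :=
  spatial x ρ * (P (radius x) * spaceDelta μ ν + Q (radius x) * (spatial x μ * spatial x ν)
    + V (radius x) * (timeDelta μ * timeDelta ν))
  + timeDelta ρ * (U (radius x) * (timeDelta μ * spatial x ν + spatial x μ * timeDelta ν))

theorem christoffel_cartesianMetric {c : ℝ} (hc : 0 < c) {α β : ℝ → ℝ} {x : Coord}
    (hx : 0 < radius x)
    (hα : DifferentiableAt ℝ α (radius x)) (hβ : DifferentiableAt ℝ β (radius x))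
    (ρ μ ν : Fin 4) :
    christoffel (cartesianMetric c α β) ρ μ ν x =
      christoffelForm (coeffP β) (coeffQ β) (coeffU α) (coeffV c α β) ρ μ ν x := by
  have hb : ∀ σ, pd μ (fun y => cartesianMetric c α β y ν σ) x
      + pd ν (fun y => cartesianMetric c α β y μ σ) x
      - pd σ (fun y => cartesianMetric c α β y μ ν) x =
      -(c ^ 2 * Real.exp (2 * α (radius x))) * 2 * deriv α (radius x) / radius x
          * ((spatial x μ * timeDelta ν + spatial x ν * timeDelta μ) * timeDelta σ
            - spatial x σ * (timeDelta μ * timeDelta ν))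
      + (2 * deriv β (radius x) * Real.exp (2 * β (radius x)) / radius x ^ 3
          - 2 * (Real.exp (2 * β (radius x)) - 1) / radius x ^ 4)
          * (spatial x σ * (spatial x μ * spatial x ν))
      + (Real.exp (2 * β (radius x)) - 1) / radius x ^ 2 * (2 * spatial x σ * spaceDelta μ ν) := by
    intro σ
    rw [(HasPartials.cartesianMetric hx hα hβ ν σ).2, (HasPartials.cartesianMetric hx hα hβ μ σ).2,
      (HasPartials.cartesianMetric hx hα hβ μ ν).2]
    beta_reduce
    rw [spaceDelta_comm ν μ, spaceDelta_comm σ μ, spaceDelta_comm σ ν]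
    ring
  simp only [christoffel, hb, cartesianMetric_inv hc α β hx]
  -- The inverse metric maps `dt` to `a dt` and `x` to `(1 + p r²) x`, and the bracket of metric
  -- derivatives is a combination of just these two covectors in the index `σ`.
  have key : ∀ a p A B : ℝ, ∑ σ, frameTensor a 1 p x ρ σ * (A * timeDelta σ + B * spatial x σ)
      = a * A * timeDelta ρ + (1 + p * radius x ^ 2) * B * spatial x ρ := by
    intro a p A B
    have : ∀ σ, frameTensor a 1 p x ρ σ * (A * timeDelta σ + B * spatial x σ) =
      a * A * timeDelta ρ * (timeDelta σ * timeDelta σ)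
      + (a * B * timeDelta ρ + p * A * spatial x ρ) * (spatial x σ * timeDelta σ)
      + A * (spaceDelta ρ σ * timeDelta σ) + B * (spaceDelta ρ σ * spatial x σ)
      + p * B * spatial x ρ * (spatial x σ * spatial x σ) := fun σ => by
        unfold frameTensor; ring
    simp only [this, Finset.sum_add_distrib, ← Finset.mul_sum, sum_spatial_mul_spatial,
      sum_spatial_mul_timeDelta, sum_timeDelta_mul_timeDelta, sum_spaceDelta_mul_spatial,
      sum_spaceDelta_mul_timeDelta]
    ring
  have e := key (-(1 / (c ^ 2 * Real.exp (2 * α (radius x))))) (-coeffP β (radius x))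
    (-(c ^ 2 * Real.exp (2 * α (radius x))) * 2 * deriv α (radius x) / radius x
          * (spatial x μ * timeDelta ν + spatial x ν * timeDelta μ))
    (-(-(c ^ 2 * Real.exp (2 * α (radius x))) * 2 * deriv α (radius x) / radius x)
        * (timeDelta μ * timeDelta ν)
      + (2 * deriv β (radius x) * Real.exp (2 * β (radius x)) / radius x ^ 3
          - 2 * (Real.exp (2 * β (radius x)) - 1) / radius x ^ 4)
          * (spatial x μ * spatial x ν)
      + (Real.exp (2 * β (radius x)) - 1) / radius x ^ 2 * (2 * spaceDelta μ ν))
  rw [Finset.sum_congr rfl fun σ _ => ?_, e]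
  · simp only [christoffelForm, coeffP, coeffQ, coeffU, coeffV, Real.exp_neg]
    have hE := (Real.exp_pos (2 * β (radius x))).ne'
    have hF := (Real.exp_pos (2 * α (radius x))).ne'
    field_simp
    ring
  · ring

theorem HasPartials.christoffelForm {P Q U V : ℝ → ℝ} {P' Q' U' V' : ℝ} {x : Coord}
    (hx : 0 < radius x) (hP : HasDerivAt P P' (radius x)) (hQ : HasDerivAt Q Q' (radius x))
    (hU : HasDerivAt U U' (radius x)) (hV : HasDerivAt V V' (radius x)) (ρ μ ν : Fin 4) :
    HasPartials (StaticBianchi.christoffelForm P Q U V ρ μ ν) (fun κ =>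
      spaceDelta κ ρ * (P (radius x) * spaceDelta μ ν
        + Q (radius x) * (StaticBianchi.spatial x μ * StaticBianchi.spatial x ν)
        + V (radius x) * (timeDelta μ * timeDelta ν))
      + StaticBianchi.spatial x ρ * (P' / radius x * StaticBianchi.spatial x κ * spaceDelta μ ν
        + Q' / radius x * StaticBianchi.spatial x κ
          * (StaticBianchi.spatial x μ * StaticBianchi.spatial x ν)
        + Q (radius x) * (spaceDelta κ μ * StaticBianchi.spatial x ν
          + StaticBianchi.spatial x μ * spaceDelta κ ν)
        + V' / radius x * StaticBianchi.spatial x κ * (timeDelta μ * timeDelta ν))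
      + timeDelta ρ * (U' / radius x * StaticBianchi.spatial x κ
          * (timeDelta μ * StaticBianchi.spatial x ν + StaticBianchi.spatial x μ * timeDelta ν)
        + U (radius x) * (timeDelta μ * spaceDelta κ ν + spaceDelta κ μ * timeDelta ν))) x := by
  have s := fun i => HasPartials.spatial i x
  have k := fun a => HasPartials.const a x
  have h := ((s ρ).mul ((((HasPartials.radial hx hP).mul (k (spaceDelta μ ν))).add
      ((HasPartials.radial hx hQ).mul ((s μ).mul (s ν)))).add
      ((HasPartials.radial hx hV).mul (k (timeDelta μ * timeDelta ν))))).add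
    ((k (timeDelta ρ)).mul ((HasPartials.radial hx hU).mul
      (((k (timeDelta μ)).mul (s ν)).add ((s μ).mul (k (timeDelta ν))))))
  exact h.congr_partials fun κ => by ring

/-! ### Curvature and volume in Cartesian coordinates -/

/-- The terms with `Q'` in `∂_ρ Γ^ρ_{μν}` and `∂_ν Γ^ρ_{ρμ}` cancel. As `coeffQ` is the only
coefficient containing `β'`, no second derivative of `β` enters the curvature. -/
theorem ricci_of_christoffelForm {g : MetricField} {P Q U V : ℝ → ℝ} {P' Q' U' V' : ℝ} {x : Coord}
    (hx : 0 < radius x)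
    (hg : ∀ y, 0 < radius y → ∀ ρ μ ν,
      christoffel g ρ μ ν y = christoffelForm P Q U V ρ μ ν y)
    (hP : HasDerivAt P P' (radius x)) (hQ : HasDerivAt Q Q' (radius x))
    (hU : HasDerivAt U U' (radius x)) (hV : HasDerivAt V V' (radius x)) (μ ν : Fin 4) :
    ricci g μ ν x = frameTensor
      (3 * V (radius x) + radius x * V'
        + (P (radius x) + Q (radius x) * radius x ^ 2 - U (radius x)) * radius x ^ 2 * V (radius x))
      (2 * P (radius x) + radius x * P' - Q (radius x) * radius x ^ 2 - U (radius x)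
        + (P (radius x) + Q (radius x) * radius x ^ 2 + U (radius x)) * radius x ^ 2 * P (radius x))
      (3 * Q (radius x) - P' / radius x - U' / radius x
        + (P (radius x) + Q (radius x) * radius x ^ 2 + U (radius x)) * radius x ^ 2 * Q (radius x)
        - (P (radius x) + Q (radius x) * radius x ^ 2) ^ 2 - U (radius x) ^ 2) x μ ν := by
  have hpd : ∀ κ ρ μ ν, pd κ (christoffel g ρ μ ν) x = _ := fun κ ρ μ ν =>
    ((HasPartials.christoffelForm hx hP hQ hU hV ρ μ ν).congr
      (Filter.mem_of_superset (isOpen_radius_pos.mem_nhds hx) fun y hy => hg y hy ρ μ ν)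
      fun _ => rfl).2 κ
  simp only [ricci, riemann, hpd, hg x hx, christoffelForm]
  have eP : radius x * P' = radius x ^ 2 * (P' / radius x) := by field_simp
  have eV : radius x * V' = radius x ^ 2 * (V' / radius x) := by field_simp
  rw [eP, eV]
  have hr := radius_sq x
  generalize P' / radius x = Ph
  generalize V' / radius x = Vh
  generalize Q' / radius x = Qh
  generalize U' / radius x = Uh
  generalize P (radius x) = P
  generalize Q (radius x) = Q
  generalize U (radius x) = U
  generalize V (radius x) = V
  rw [hr]
  simp only [Fin.sum_univ_four, frameTensor]
  fin_cases μ <;> fin_cases ν <;> simp [spatial, timeDelta, spaceDelta] <;> ring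

/-- The component `G^t_t` as a function of `r`. -/
def einsteinTT (β : ℝ → ℝ) (r : ℝ) : ℝ :=
  Real.exp (-(2 * β r)) * (1 - Real.exp (2 * β r) - 2 * r * deriv β r) / r ^ 2

/-- The component `G^r_r` as a function of `r`. -/
def einsteinRR (α β : ℝ → ℝ) (r : ℝ) : ℝ :=
  Real.exp (-(2 * β r)) * (1 - Real.exp (2 * β r) + 2 * r * deriv α r) / r ^ 2

/-- The component `G^θ_θ` as a function of `r`. -/
def einsteinAngular (α β : ℝ → ℝ) (r : ℝ) : ℝ :=
  Real.exp (-(2 * β r)) *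
    ((1 + r * deriv α r) * (deriv α r - deriv β r) + r * deriv (deriv α) r) / r

theorem hasDerivAt_coeffP {β : ℝ → ℝ} {b r : ℝ} (hr : 0 < r) (hβ : HasDerivAt β b r) :
    HasDerivAt (coeffP β) (2 * b * Real.exp (-(2 * β r)) / r ^ 2
      - 2 * (1 - Real.exp (-(2 * β r))) / r ^ 3) r := by
  have h := (((hβ.const_mul 2).neg.exp).const_sub 1).div (hasDerivAt_pow 2 r) (by positivity)
  refine h.congr_deriv ?_
  simp only [Pi.neg_apply]
  field_simp
  push_cast
  ring

/-- A frame tensor with coefficients `a`, `b`, `p` has eigenvalue `a` in time, `b` on directions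
tangent to the spheres and `b + p r²` along `x`. The coefficient of `x_i x_j` is the one that makes
the radial eigenvalue equal to `G^r_r`. -/
theorem einstein_cartesianMetric {c : ℝ} (hc : 0 < c) {α β : ℝ → ℝ}
    (hα : ContDiffOn ℝ 3 α (Ioi 0)) (hβ : ContDiffOn ℝ 3 β (Ioi 0)) {x : Coord}
    (hx : 0 < radius x) (μ ν : Fin 4) :
    einstein (cartesianMetric c α β) μ ν x =
      frameTensor (einsteinTT β (radius x)) (einsteinAngular α β (radius x))
        ((einsteinRR α β (radius x) - einsteinAngular α β (radius x)) / radius x ^ 2) x μ ν := by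
  have dα : ∀ {r : ℝ}, 0 < r → DifferentiableAt ℝ α r := fun {r} hr =>
    (hα.differentiableOn (by norm_num)).differentiableAt (Ioi_mem_nhds hr)
  have dβ : ∀ {r : ℝ}, 0 < r → DifferentiableAt ℝ β r := fun {r} hr =>
    (hβ.differentiableOn (by norm_num)).differentiableAt (Ioi_mem_nhds hr)
  have ddα : DifferentiableAt ℝ (deriv α) (radius x) :=
    ((hα.deriv_of_isOpen (m := 2) isOpen_Ioi (by norm_num)).differentiableOn
      (by norm_num)).differentiableAt (Ioi_mem_nhds hx)
  have ddβ : DifferentiableAt ℝ (deriv β) (radius x) :=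
    ((hβ.deriv_of_isOpen (m := 2) isOpen_Ioi (by norm_num)).differentiableOn
      (by norm_num)).differentiableAt (Ioi_mem_nhds hx)
  have hP := hasDerivAt_coeffP hx (dβ hx).hasDerivAt
  -- Differentiability is enough: the value of this derivative drops out of the Ricci tensor.
  have hQ : DifferentiableAt ℝ (coeffQ β) (radius x) := by
    have := dβ hx
    unfold coeffQ
    fun_prop (disch := positivity)
  have hU : HasDerivAt (coeffU α)
      (deriv (deriv α) (radius x) / radius x - deriv α (radius x) / radius x ^ 2) (radius x) := by
    refine (ddα.hasDerivAt.div (hasDerivAt_id (radius x)) hx.ne').congr_deriv ?_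
    simp only [id]
    field_simp
  have hV : HasDerivAt (coeffV c α β)
      (c ^ 2 * Real.exp (2 * α (radius x)) * Real.exp (-(2 * β (radius x))) *
        ((2 * (deriv α (radius x) - deriv β (radius x)) * deriv α (radius x)
          + deriv (deriv α) (radius x)) / radius x - deriv α (radius x) / radius x ^ 2))
      (radius x) := by
    have h := (((((dα hx).hasDerivAt.const_mul 2).exp.const_mul (c ^ 2)).mul
      ((dβ hx).hasDerivAt.const_mul 2).neg.exp).mul ddα.hasDerivAt).div
      (hasDerivAt_id (radius x)) hx.ne'
    refine h.congr_deriv ?_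
    simp only [Pi.neg_apply, Pi.mul_apply, id]
    field_simp
    ring
  have hric := ricci_of_christoffelForm hx
    (fun y hy ρ μ ν => christoffel_cartesianMetric hc hy (dα hy) (dβ hy) ρ μ ν)
    hP hQ.hasDerivAt hU hV
  simp only [einstein, scalarCurvature, ricciMixed, hric, cartesianMetric_inv hc α β hx,
    sum_frameTensor_mul, frameTensor_trace, one_eq_frameTensor x]
  simp only [frameTensor, einsteinTT, einsteinRR, einsteinAngular, coeffP, coeffQ, coeffU, coeffV,
    Real.exp_neg]
  have hE := (Real.exp_pos (2 * β (radius x))).ne'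
  have hF := (Real.exp_pos (2 * α (radius x))).ne'
  generalize Real.exp (2 * β (radius x)) = E at *
  generalize Real.exp (2 * α (radius x)) = F at *
  generalize timeDelta μ * timeDelta ν = T
  generalize spatial x μ * spatial x ν = S
  generalize spaceDelta μ ν = D
  generalize deriv (deriv α) (radius x) = a2
  generalize deriv α (radius x) = a1
  generalize deriv β (radius x) = b1
  generalize radius x = r at *
  field_simp
  ring

theorem volDensity_cartesianMetric {c : ℝ} (hc : 0 < c) (α β : ℝ → ℝ) {x : Coord}
    (hx : 0 < radius x) :
    volDensity (cartesianMetric c α β) x = c * Real.exp (α (radius x) + β (radius x)) := by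
  have hdet : (cartesianMetric c α β x).det =
      -(c * Real.exp (α (radius x) + β (radius x))) ^ 2 := by
    have hm : cartesianMetric c α β x = Matrix.of (frameTensor _ 1 _ x) :=
      Matrix.ext fun μ ν => cartesianMetric_apply c α β x μ ν
    -- Eliminating `x 3` turns the expanded determinant into a polynomial identity; the value is the
    -- product of the eigenvalues `-c² e^{2α}`, `e^{2β}`, `1`, `1`.
    have h3 : x 3 ^ 2 = radius x ^ 2 - x 1 ^ 2 - x 2 ^ 2 := by rw [radius_sq]; ring
    have hE : Real.exp (α (radius x) + β (radius x)) ^ 2 =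
        Real.exp (2 * α (radius x)) * Real.exp (2 * β (radius x)) := by
      rw [← Real.exp_add, ← Real.exp_nat_mul]; push_cast; ring_nf
    rw [mul_pow, hE, hm]
    simp [Matrix.det_succ_row_zero, Fin.sum_univ_succ, Fin.succAbove, frameTensor, timeDelta,
      spaceDelta, spatial]
    generalize Real.exp (2 * β (radius x)) = E
    generalize Real.exp (2 * α (radius x)) = F
    field_simp
    linear_combination (radius x ^ 4 * F * (E - 1)) * h3
  rw [volDensity, hdet, abs_neg, abs_of_nonneg (by positivity), Real.sqrt_sq (by positivity)]

/-! ### Curvature in spherical coordinates -/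

/-- The region on which the spherical coordinates are regular. -/
def sphericalChart : Set Coord := {y | 0 < y 1 ∧ 0 < Real.sin (y 2)}

theorem isOpen_sphericalChart : IsOpen sphericalChart :=
  (isOpen_lt continuous_const (continuous_apply 1)).inter
    (isOpen_lt continuous_const (Real.continuous_sin.comp (continuous_apply 2)))

/-- The nonzero Christoffel symbols of the metric in spherical coordinates. -/
def sphericalChristoffel (c : ℝ) (α β : ℝ → ℝ) (ρ μ ν : Fin 4) (y : Coord) : ℝ :=
  (![![![0, deriv α (y 1), 0, 0],
       ![deriv α (y 1), 0, 0, 0], 0, 0],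
     ![![c ^ 2 * Real.exp (2 * α (y 1)) * Real.exp (-(2 * β (y 1))) * deriv α (y 1), 0, 0, 0],
       ![0, deriv β (y 1), 0, 0],
       ![0, 0, -(y 1 * Real.exp (-(2 * β (y 1)))), 0],
       ![0, 0, 0, -(y 1 * Real.exp (-(2 * β (y 1))) * Real.sin (y 2) ^ 2)]],
     ![0, ![0, 0, 1 / y 1, 0], ![0, 1 / y 1, 0, 0],
       ![0, 0, 0, -(Real.sin (y 2) * Real.cos (y 2))]],
     ![0, ![0, 0, 0, 1 / y 1], ![0, 0, 0, Real.cos (y 2) / Real.sin (y 2)],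
       ![0, 1 / y 1, Real.cos (y 2) / Real.sin (y 2), 0]]] :
    Fin 4 → Fin 4 → Fin 4 → ℝ) ρ μ ν

theorem sphericalMetric_inv {c : ℝ} (hc : 0 < c) (α β : ℝ → ℝ) {y : Coord}
    (hy : y ∈ sphericalChart) :
    (sphericalMetric c α β y)⁻¹ = Matrix.diagonal ![-(1 / (c ^ 2 * Real.exp (2 * α (y 1)))),
      Real.exp (-(2 * β (y 1))), 1 / (y 1) ^ 2, 1 / ((y 1) ^ 2 * Real.sin (y 2) ^ 2)] := by
  apply Matrix.inv_eq_right_inv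
  have h1 : y 1 ≠ 0 := hy.1.ne'
  have h2 : Real.sin (y 2) ≠ 0 := hy.2.ne'
  rw [sphericalMetric, Matrix.diagonal_mul_diagonal, ← Matrix.diagonal_one]
  congr 1
  funext i
  fin_cases i <;> simp [Real.exp_neg] <;> field_simp

theorem HasPartials.sphericalMetric {c : ℝ} {α β : ℝ → ℝ} {y : Coord}
    (hα : DifferentiableAt ℝ α (y 1)) (hβ : DifferentiableAt ℝ β (y 1)) (μ ν : Fin 4) :
    HasPartials (fun z => StaticBianchi.sphericalMetric c α β z μ ν) (fun κ =>
      if μ = ν then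
        ((![![0, 0, 0, 0],
          ![-(c ^ 2 * Real.exp (2 * α (y 1)) * (2 * deriv α (y 1))),
            Real.exp (2 * β (y 1)) * (2 * deriv β (y 1)), 2 * y 1, 2 * y 1 * Real.sin (y 2) ^ 2],
          ![0, 0, 0, y 1 ^ 2 * (2 * Real.sin (y 2) * Real.cos (y 2))],
          ![0, 0, 0, 0]] : Fin 4 → Fin 4 → ℝ) κ μ)
      else 0) y := by
  by_cases h : μ = ν
  · subst h
    have h1 := HasPartials.coord 1 y
    have h2 := HasPartials.comp (Real.hasDerivAt_sin (y 2)) (HasPartials.coord 2 y)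
    have hA := (HasPartials.const (-(c ^ 2)) y).mul
      (HasPartials.comp (hα.hasDerivAt.const_mul 2).exp h1)
    have hB := HasPartials.comp (hβ.hasDerivAt.const_mul 2).exp h1
    have hC := h1.mul h1
    have hD := hC.mul (h2.mul h2)
    fin_cases μ
    · refine hA.congr (.of_forall fun z => ?_) fun κ => ?_
      · simp [StaticBianchi.sphericalMetric]
      · fin_cases κ <;> simp; ring
    · refine hB.congr (.of_forall fun z => ?_) fun κ => ?_
      · simp [StaticBianchi.sphericalMetric]
      · fin_cases κ <;> simp
    · refine hC.congr (.of_forall fun z => ?_) fun κ => ?_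
      · simp [StaticBianchi.sphericalMetric]; ring
      · fin_cases κ <;> simp; ring
    · refine hD.congr (.of_forall fun z => ?_) fun κ => ?_
      · simp [StaticBianchi.sphericalMetric]; ring
      · fin_cases κ <;> simp <;> ring
  · refine (HasPartials.const 0 y).congr (.of_forall fun z => ?_) fun κ => ?_
    · simp [StaticBianchi.sphericalMetric, h]
    · simp [h]

theorem christoffel_sphericalMetric {c : ℝ} (hc : 0 < c) {α β : ℝ → ℝ} {y : Coord}
    (hy : y ∈ sphericalChart) (hα : DifferentiableAt ℝ α (y 1)) (hβ : DifferentiableAt ℝ β (y 1))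
    (ρ μ ν : Fin 4) :
    christoffel (sphericalMetric c α β) ρ μ ν y = sphericalChristoffel c α β ρ μ ν y := by
  have h1 : y 1 ≠ 0 := hy.1.ne'
  have h2 : Real.sin (y 2) ≠ 0 := hy.2.ne'
  simp only [christoffel, sphericalMetric_inv hc α β hy, sphericalChristoffel]
  rw [Finset.sum_eq_single ρ
    (fun σ _ h => by rw [Matrix.diagonal_apply_ne _ h.symm, zero_mul]) (by simp),
    Matrix.diagonal_apply_eq, (HasPartials.sphericalMetric hα hβ _ _).2,
    (HasPartials.sphericalMetric hα hβ _ _).2, (HasPartials.sphericalMetric hα hβ _ _).2]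
  fin_cases ρ <;> fin_cases μ <;> fin_cases ν <;> simp [Real.exp_neg] <;> field_simp

/-- The partial derivatives of the Christoffel symbols at `θ = π / 2`. -/
def sphericalChristoffelPartial (c : ℝ) (α β : ℝ → ℝ) (ρ μ ν κ : Fin 4) (r : ℝ) : ℝ :=
  (![0,
     ![![![0, deriv (deriv α) r, 0, 0], ![deriv (deriv α) r, 0, 0, 0], 0, 0],
       ![![c ^ 2 * Real.exp (2 * α r) * Real.exp (-(2 * β r)) *
            (2 * (deriv α r - deriv β r) * deriv α r + deriv (deriv α) r), 0, 0, 0],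
         ![0, deriv (deriv β) r, 0, 0],
         ![0, 0, -(Real.exp (-(2 * β r)) * (1 - 2 * r * deriv β r)), 0],
         ![0, 0, 0, -(Real.exp (-(2 * β r)) * (1 - 2 * r * deriv β r))]],
       ![0, ![0, 0, -(1 / r ^ 2), 0], ![0, -(1 / r ^ 2), 0, 0], 0],
       ![0, ![0, 0, 0, -(1 / r ^ 2)], 0, ![0, -(1 / r ^ 2), 0, 0]]],
     ![0, 0, ![0, 0, 0, ![0, 0, 0, 1]], ![0, 0, ![0, 0, 0, -1], ![0, 0, -1, 0]]],
     0] : Fin 4 → Fin 4 → Fin 4 → Fin 4 → ℝ) κ ρ μ ν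

theorem HasPartials.sphericalChristoffel (c : ℝ) {α β : ℝ → ℝ} {r : ℝ} (hr : 0 < r)
    (hα : DifferentiableAt ℝ α r) (hβ : DifferentiableAt ℝ β r)
    (hα' : DifferentiableAt ℝ (deriv α) r) (hβ' : DifferentiableAt ℝ (deriv β) r)
    (ρ μ ν : Fin 4) :
    HasPartials (StaticBianchi.sphericalChristoffel c α β ρ μ ν)
      (fun κ => sphericalChristoffelPartial c α β ρ μ ν κ r) ![0, r, Real.pi / 2, 0] := by
  set y : Coord := ![0, r, Real.pi / 2, 0] with hy
  have hy1 : y 1 = r := by simp [hy]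
  have hy2 : y 2 = Real.pi / 2 := by simp [hy]
  have h1 := HasPartials.coord 1 y
  have hs := HasPartials.comp (Real.hasDerivAt_sin (y 2)) (HasPartials.coord 2 y)
  have hcs := HasPartials.comp (Real.hasDerivAt_cos (y 2)) (HasPartials.coord 2 y)
  have ht := HasPartials.comp ((Real.hasDerivAt_cos (y 2)).div (Real.hasDerivAt_sin (y 2))
    (by simp [hy2])) (HasPartials.coord 2 y)
  have ha1 : HasPartials (fun z => deriv α (z 1)) _ y :=
    HasPartials.comp (by rw [hy1]; exact hα'.hasDerivAt) h1
  have hb1 : HasPartials (fun z => deriv β (z 1)) _ y :=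
    HasPartials.comp (by rw [hy1]; exact hβ'.hasDerivAt) h1
  have hE : HasPartials (fun z => Real.exp (-(2 * β (z 1)))) _ y :=
    HasPartials.comp (h := fun s => Real.exp (-(2 * β s)))
      (by rw [hy1]; exact (hβ.hasDerivAt.const_mul 2).neg.exp) h1
  have hF : HasPartials (fun z => Real.exp (2 * α (z 1))) _ y :=
    HasPartials.comp (h := fun s => Real.exp (2 * α s))
      (by rw [hy1]; exact (hα.hasDerivAt.const_mul 2).exp) h1
  have hI : HasPartials (fun z => 1 / z 1) _ y :=
    HasPartials.comp (h := fun s => 1 / s)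
      (by rw [hy1]; exact (hasDerivAt_const r (1 : ℝ)).div (hasDerivAt_id r) hr.ne') h1
  have hV := (((HasPartials.const (c ^ 2) y).mul hF).mul hE).mul ha1
  have hW := (h1.mul hE).neg
  have hX := ((h1.mul hE).mul (hs.mul hs)).neg
  have hT := (hs.mul hcs).neg
  have hz := HasPartials.const 0 y
  have key : ∀ {f : Coord → ℝ} {v : Fin 4 → ℝ}, HasPartials f v y →
      (∀ z, StaticBianchi.sphericalChristoffel c α β ρ μ ν z = f z) →
      (∀ κ, v κ = sphericalChristoffelPartial c α β ρ μ ν κ r) →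
      HasPartials (StaticBianchi.sphericalChristoffel c α β ρ μ ν)
        (fun κ => sphericalChristoffelPartial c α β ρ μ ν κ r) y :=
    fun hf he hv => hf.congr (.of_forall he) hv
  -- The 64 symbols have nine shapes: `0`, `α'`, `β'`, `1/r`, `-r e^{-2β}`, `-sin cos`, `cot`, the
  -- `tt` term, and `-r e^{-2β} sin²`. The alternatives try them in this order.
  fin_cases ρ <;> fin_cases μ <;> fin_cases ν <;>
    first
    | (refine key hz (fun z => ?_) (fun κ => ?_)
       · simp [StaticBianchi.sphericalChristoffel]
       · fin_cases κ <;> simp [sphericalChristoffelPartial])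
    | (refine key ha1 (fun z => ?_) (fun κ => ?_)
       · simp [StaticBianchi.sphericalChristoffel]
       · fin_cases κ <;> simp [sphericalChristoffelPartial])
    | (refine key hb1 (fun z => ?_) (fun κ => ?_)
       · simp [StaticBianchi.sphericalChristoffel]
       · fin_cases κ <;> simp [sphericalChristoffelPartial])
    | (refine key hI (fun z => ?_) (fun κ => ?_)
       · simp [StaticBianchi.sphericalChristoffel]
       · fin_cases κ <;> simp [sphericalChristoffelPartial, neg_div])
    | (refine key hW (fun z => ?_) (fun κ => ?_)
       · simp [StaticBianchi.sphericalChristoffel]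
       · fin_cases κ <;> simp [sphericalChristoffelPartial, hy1]; ring)
    | (refine key hT (fun z => ?_) (fun κ => ?_)
       · simp [StaticBianchi.sphericalChristoffel]
       · fin_cases κ <;> simp [sphericalChristoffelPartial, hy2])
    | (refine key ht (fun z => ?_) (fun κ => ?_)
       · simp [StaticBianchi.sphericalChristoffel]
       · fin_cases κ <;> simp [sphericalChristoffelPartial, hy2])
    | (refine key hV (fun z => ?_) (fun κ => ?_)
       · simp [StaticBianchi.sphericalChristoffel]
       · fin_cases κ <;> simp [sphericalChristoffelPartial, hy1]; ring)
    | (refine key hX (fun z => ?_) (fun κ => ?_)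
       · simp [StaticBianchi.sphericalChristoffel, sq]
       · fin_cases κ <;> simp [sphericalChristoffelPartial, hy1, hy2]; ring)

theorem sphericalEinstein_eq {c : ℝ} (hc : 0 < c) {α β : ℝ → ℝ}
    (hα : ContDiffOn ℝ 3 α (Ioi 0)) (hβ : ContDiffOn ℝ 3 β (Ioi 0)) {r : ℝ} (hr : 0 < r) :
    sphericalEinstein c α β 0 0 r = einsteinTT β r ∧
    sphericalEinstein c α β 1 1 r = einsteinRR α β r ∧
    sphericalEinstein c α β 2 2 r = einsteinAngular α β r := by
  have dα : ∀ {r : ℝ}, 0 < r → DifferentiableAt ℝ α r := fun {r} hr =>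
    (hα.differentiableOn (by norm_num)).differentiableAt (Ioi_mem_nhds hr)
  have dβ : ∀ {r : ℝ}, 0 < r → DifferentiableAt ℝ β r := fun {r} hr =>
    (hβ.differentiableOn (by norm_num)).differentiableAt (Ioi_mem_nhds hr)
  have ddα : DifferentiableAt ℝ (deriv α) r :=
    ((hα.deriv_of_isOpen (m := 2) isOpen_Ioi (by norm_num)).differentiableOn
      (by norm_num)).differentiableAt (Ioi_mem_nhds hr)
  have ddβ : DifferentiableAt ℝ (deriv β) r :=
    ((hβ.deriv_of_isOpen (m := 2) isOpen_Ioi (by norm_num)).differentiableOn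
      (by norm_num)).differentiableAt (Ioi_mem_nhds hr)
  have hy : ![0, r, Real.pi / 2, 0] ∈ sphericalChart := by simp [sphericalChart, hr]
  -- The symbols are identified on a whole neighbourhood before differentiating; setting `θ = π / 2`
  -- earlier would lose the `θ`-derivatives of `cot` and `sin cos`.
  have hpd : ∀ κ ρ μ ν, pd κ (christoffel (sphericalMetric c α β) ρ μ ν) ![0, r, Real.pi / 2, 0]
      = sphericalChristoffelPartial c α β ρ μ ν κ r := fun κ ρ μ ν =>
    ((HasPartials.sphericalChristoffel c hr (dα hr) (dβ hr) ddα ddβ ρ μ ν).congr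
      (Filter.mem_of_superset (isOpen_sphericalChart.mem_nhds hy) fun z hz =>
        christoffel_sphericalMetric hc hz (dα hz.1) (dβ hz.1) ρ μ ν)
      fun _ => rfl).2 κ
  have hch : ∀ ρ μ ν, christoffel (sphericalMetric c α β) ρ μ ν ![0, r, Real.pi / 2, 0] =
      sphericalChristoffel c α β ρ μ ν ![0, r, Real.pi / 2, 0] := fun ρ μ ν =>
    christoffel_sphericalMetric hc hy (dα hr) (dβ hr) ρ μ ν
  have hmix : ∀ μ, ricciMixed (sphericalMetric c α β) μ μ ![0, r, Real.pi / 2, 0] =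
      (![-(1 / (c ^ 2 * Real.exp (2 * α r))), Real.exp (-(2 * β r)), 1 / r ^ 2, 1 / r ^ 2]
        : Fin 4 → ℝ) μ * ricci (sphericalMetric c α β) μ μ ![0, r, Real.pi / 2, 0] := by
    intro μ
    rw [ricciMixed, sphericalMetric_inv hc α β hy, Finset.sum_eq_single μ
      (fun σ _ h => by rw [Matrix.diagonal_apply_ne _ h.symm, zero_mul]) (by simp),
      Matrix.diagonal_apply_eq]
    fin_cases μ <;> simp
  have h0 : ricci (sphericalMetric c α β) 0 0 ![0, r, Real.pi / 2, 0] =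
      c ^ 2 * Real.exp (2 * α r) * Real.exp (-(2 * β r)) * (deriv (deriv α) r
        + deriv α r ^ 2 - deriv α r * deriv β r + 2 * deriv α r / r) := by
    simp only [ricci, riemann, hpd, hch, Fin.sum_univ_four]
    simp [sphericalChristoffelPartial, sphericalChristoffel]
    ring
  have h1 : ricci (sphericalMetric c α β) 1 1 ![0, r, Real.pi / 2, 0] =
      -(deriv (deriv α) r) - deriv α r ^ 2 + deriv α r * deriv β r + 2 * deriv β r / r := by
    simp only [ricci, riemann, hpd, hch, Fin.sum_univ_four]
    simp [sphericalChristoffelPartial, sphericalChristoffel]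
    field_simp
    ring
  have h2 : ricci (sphericalMetric c α β) 2 2 ![0, r, Real.pi / 2, 0] =
      1 + Real.exp (-(2 * β r)) * (r * (deriv β r - deriv α r) - 1) := by
    simp only [ricci, riemann, hpd, hch, Fin.sum_univ_four]
    simp [sphericalChristoffelPartial, sphericalChristoffel]
    field_simp
    ring
  have h3 : ricci (sphericalMetric c α β) 3 3 ![0, r, Real.pi / 2, 0] =
      1 + Real.exp (-(2 * β r)) * (r * (deriv β r - deriv α r) - 1) := by
    simp only [ricci, riemann, hpd, hch, Fin.sum_univ_four]
    simp [sphericalChristoffelPartial, sphericalChristoffel]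
    field_simp
    ring
  simp only [sphericalEinstein, einstein, scalarCurvature, Fin.sum_univ_four, hmix, h0, h1, h2, h3,
    einsteinTT, einsteinRR, einsteinAngular, Real.exp_neg]
  have hE := (Real.exp_pos (2 * β r)).ne'
  have hF := (Real.exp_pos (2 * α r)).ne'
  refine ⟨?_, ?_, ?_⟩ <;> simp <;> field_simp <;> ring

/-! ### The Bianchi identity as a vanishing divergence -/

/-- The vector field obtained by contracting a static spherically symmetric tensor density
with `ψ`. -/
def flux (a b p D : ℝ → ℝ) (ψ : Coord → Coord) (μ : Fin 4) (y : Coord) : ℝ :=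
  D (radius y) * ∑ ν, frameTensor (a (radius y)) (b (radius y)) (p (radius y)) y μ ν * ψ y ν

theorem HasPartials.flux {a b p D : ℝ → ℝ} {a' b' p' D' : ℝ} {ψ : Coord → Coord} {x : Coord}
    (hx : 0 < radius x) (ha : HasDerivAt a a' (radius x)) (hb : HasDerivAt b b' (radius x))
    (hp : HasDerivAt p p' (radius x)) (hD : HasDerivAt D D' (radius x))
    (hψ : DifferentiableAt ℝ ψ x) (μ : Fin 4) :
    HasPartials (StaticBianchi.flux a b p D ψ μ) (fun κ =>
      ∑ ν, (D' / radius x * StaticBianchi.spatial x κ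
          * (frameTensor (a (radius x)) (b (radius x)) (p (radius x)) x μ ν * ψ x ν)
        + D (radius x) * ((a' / radius x * StaticBianchi.spatial x κ * (timeDelta μ * timeDelta ν)
          + b' / radius x * StaticBianchi.spatial x κ * spaceDelta μ ν
          + (p' / radius x * StaticBianchi.spatial x κ
              * (StaticBianchi.spatial x μ * StaticBianchi.spatial x ν)
            + p (radius x) * (spaceDelta κ μ * StaticBianchi.spatial x ν
              + StaticBianchi.spatial x μ * spaceDelta κ ν))) * ψ x ν
          + frameTensor (a (radius x)) (b (radius x)) (p (radius x)) x μ ν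
            * pd κ (fun y => ψ y ν) x))) x := by
  have hψ' : ∀ ν, HasPartials (fun y => ψ y ν) (fun κ => pd κ (fun y => ψ y ν) x) x := fun ν =>
    ⟨differentiableAt_pi.1 hψ ν, fun _ => rfl⟩
  have s := fun i => HasPartials.spatial i x
  have k := fun a => HasPartials.const a x
  have h := fun ν => (HasPartials.radial hx hD).mul
    (((((HasPartials.radial hx ha).mul (k (timeDelta μ * timeDelta ν))).add
      ((HasPartials.radial hx hb).mul (k (spaceDelta μ ν)))).add
      ((HasPartials.radial hx hp).mul ((s μ).mul (s ν)))).mul (hψ' ν))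
  refine ((((h 0).add (h 1)).add (h 2)).add (h 3)).congr (.of_forall fun y => ?_) fun κ => ?_
  · simp only [StaticBianchi.flux, Fin.sum_univ_four, frameTensor]
    ring
  · simp only [Fin.sum_univ_four, frameTensor]
    ring

/-- By the product rule, the divergence of the flux differs from the contraction with `∇ψ` by the
covariant divergence of the tensor paired with `ψ`. By symmetry that covector is a multiple of `x`,
and `hdiv` says that the multiple is zero. The function `D` plays the role of `√|g|`. -/
theorem divergence_flux {a b p D P Q U V : ℝ → ℝ} {a' b' p' D' : ℝ} {ψ : Coord → Coord} {x : Coord}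
    (hx : 0 < radius x) (ha : HasDerivAt a a' (radius x)) (hb : HasDerivAt b b' (radius x))
    (hp : HasDerivAt p p' (radius x)) (hD : HasDerivAt D D' (radius x))
    (hψ : DifferentiableAt ℝ ψ x)
    (hdiv : D' / radius x * (b (radius x) + p (radius x) * radius x ^ 2)
        + D (radius x) * (b' / radius x + p' / radius x * radius x ^ 2 + 4 * p (radius x)) =
      D (radius x) * (a (radius x) * U (radius x) + (b (radius x) + p (radius x) * radius x ^ 2)
        * (P (radius x) + Q (radius x) * radius x ^ 2))) :
    ∑ μ, pd μ (flux a b p D ψ μ) x = (∑ μ, ∑ ν,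
      frameTensor (a (radius x)) (b (radius x)) (p (radius x)) x μ ν
        * (pd μ (fun y => ψ y ν) x + ∑ κ, christoffelForm P Q U V ν μ κ x * ψ x κ))
      * D (radius x) := by
  simp only [(HasPartials.flux hx ha hb hp hD hψ _).2]
  simp only [christoffelForm]
  generalize (fun μ ν => pd μ (fun y => ψ y ν) x) = dψ
  rw [radius_sq] at hdiv
  generalize a' / radius x = a' at *
  generalize b' / radius x = b' at *
  generalize p' / radius x = p' at *
  generalize D' / radius x = D' at *
  generalize a (radius x) = a at *
  generalize b (radius x) = b at *
  generalize p (radius x) = p at *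
  generalize D (radius x) = D at *
  generalize P (radius x) = P at *
  generalize Q (radius x) = Q at *
  generalize U (radius x) = U at *
  generalize V (radius x) = V at *
  simp only [Fin.sum_univ_four, frameTensor]
  simp [spatial, timeDelta, spaceDelta]
  linear_combination (x 1 * ψ x 1 + x 2 * ψ x 2 + x 3 * ψ x 3) * hdiv

/-- The coefficient of `x_i x_j` in the Einstein tensor. -/
def einsteinShear (α β : ℝ → ℝ) (r : ℝ) : ℝ := (einsteinRR α β r - einsteinAngular α β r) / r ^ 2

/-- Integration by parts needs a `C¹` flux. The angular component contains `α''`, which is `C¹`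
exactly because `α` is `C³`. -/
theorem contDiffOn_einstein {α β : ℝ → ℝ}
    (hα : ContDiffOn ℝ 3 α (Ioi 0)) (hβ : ContDiffOn ℝ 3 β (Ioi 0)) :
    ContDiffOn ℝ 1 (einsteinTT β) (Ioi 0) ∧ ContDiffOn ℝ 1 (einsteinRR α β) (Ioi 0) ∧
      ContDiffOn ℝ 1 (einsteinAngular α β) (Ioi 0) := by
  have hα1 : ContDiffOn ℝ 2 (deriv α) (Ioi 0) := hα.deriv_of_isOpen isOpen_Ioi (by norm_num)
  have hα2 : ContDiffOn ℝ 1 (deriv (deriv α)) (Ioi 0) :=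
    hα1.deriv_of_isOpen isOpen_Ioi (by norm_num)
  have hβ1 : ContDiffOn ℝ 1 (deriv β) (Ioi 0) := hβ.deriv_of_isOpen isOpen_Ioi (by norm_num)
  have hα0 := hα.of_le (m := 1) (by norm_num)
  have hβ0 := hβ.of_le (m := 1) (by norm_num)
  have hα1 := hα1.of_le (m := 1) (by norm_num)
  have h0 : ∀ r ∈ Ioi (0 : ℝ), r ^ 2 ≠ 0 := fun r hr => pow_ne_zero 2 (ne_of_gt hr)
  have h0' : ∀ r ∈ Ioi (0 : ℝ), r ≠ 0 := fun r hr => ne_of_gt hr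
  have hE : ContDiffOn ℝ 1 (fun r => Real.exp (2 * β r)) (Ioi 0) := by fun_prop
  have hE' : ContDiffOn ℝ 1 (fun r => Real.exp (-(2 * β r))) (Ioi 0) := by fun_prop
  refine ⟨?_, ?_, ?_⟩
  · exact ContDiffOn.div (by fun_prop) (by fun_prop) h0
  · exact ContDiffOn.div (by fun_prop) (by fun_prop) h0
  · exact ContDiffOn.div (by fun_prop) (by fun_prop) h0'

/-- This is the radial component of the contracted second Bianchi identity, the only nontrivial one
here. Differentiating `G^r_r` produces `α''`, which is absorbed by `G^θ_θ`. -/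
theorem hasDerivAt_einsteinRR {α β : ℝ → ℝ} {r : ℝ} (hr : 0 < r)
    (hβ : DifferentiableAt ℝ β r) (hα' : DifferentiableAt ℝ (deriv α) r) :
    HasDerivAt (einsteinRR α β) (-(deriv α r * (einsteinRR α β r - einsteinTT β r))
      - 2 * (einsteinRR α β r - einsteinAngular α β r) / r) r := by
  have h2 : HasDerivAt (fun s : ℝ => 2 * s) 2 r := by
    simpa using (hasDerivAt_id r).const_mul (2 : ℝ)
  have h := (((hβ.hasDerivAt.const_mul 2).neg.exp).mul
    ((((hβ.hasDerivAt.const_mul 2).exp).const_sub 1).add (h2.mul hα'.hasDerivAt))).div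
      (hasDerivAt_pow 2 r) (by positivity)
  refine h.congr_deriv ?_
  simp only [Pi.neg_apply, Pi.mul_apply, Pi.add_apply, einsteinRR, einsteinTT, einsteinAngular,
    Real.exp_neg]
  have hE := (Real.exp_pos (2 * β r)).ne'
  field_simp
  push_cast
  ring

/-! ### Integration by parts away from the axis -/

/-- Integration by parts against the constant function `1`. -/
theorem integral_pd_eq_zero {f : Coord → ℝ} (hf : ContDiff ℝ 1 f) (hc : HasCompactSupport f)
    (μ : Fin 4) : ∫ x, pd μ f x = 0 := by
  have hd : Continuous (fun x => pd μ f x) :=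
    (hf.continuous_fderiv (by norm_num)).clm_apply continuous_const
  have hdc : HasCompactSupport (fun x => pd μ f x) := hc.fderiv_apply (𝕜 := ℝ) (Pi.single μ 1)
  have h := integral_mul_fderiv_eq_neg_fderiv_mul_of_integrable (μ := (volume : Measure Coord))
    (f := fun _ => (1 : ℝ)) (g := f) (v := Pi.single μ 1) (by simp)
    (by simpa [pd] using hd.integrable_of_hasCompactSupport hdc)
    (by simpa using hf.continuous.integrable_of_hasCompactSupport hc)
    (fun x _ => by fun_prop) (fun x _ => hf.contDiffAt.differentiableAt (by norm_num))
  simpa [pd] using h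

theorem contDiffAt_radius {x : Coord} (hx : 0 < radius x) : ContDiffAt ℝ 1 radius x := by
  have h2 := radius_sq x
  have : x 1 ^ 2 + x 2 ^ 2 + x 3 ^ 2 ≠ 0 := by rw [← h2]; positivity
  unfold radius
  exact ContDiffAt.sqrt (by fun_prop) this

/-- A function which is continuous off the axis and vanishes near it is continuous. -/
theorem continuous_of_continuousOn_off_axis {h : Coord → ℝ} {a : ℝ} (ha : 0 < a)
    (hc : ContinuousOn h {x | 0 < radius x}) (h0 : ∀ x, radius x < a → h x = 0) :
    Continuous h := by
  rw [continuous_iff_continuousAt]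
  intro x
  by_cases hx : 0 < radius x
  · exact hc.continuousAt (isOpen_radius_pos.mem_nhds hx)
  · have : h =ᶠ[𝓝 x] fun _ => 0 := by
      filter_upwards [(isOpen_lt continuous_radius continuous_const).mem_nhds
        (show radius x < a by linarith)] with y hy using h0 y hy
    exact continuousAt_const.congr this.symm

theorem continuousOn_pd {f : Coord → ℝ} (hf : ContDiffOn ℝ 1 f {x | 0 < radius x}) (μ : Fin 4) :
    ContinuousOn (pd μ f) {x | 0 < radius x} :=
  (hf.continuousOn_fderiv_of_isOpen isOpen_radius_pos (by norm_num)).clm_apply continuousOn_const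

theorem pd_eq_zero_of_notMem {f : Coord → ℝ} {K : Set Coord} (hK : IsClosed K)
    (hf : ∀ x ∉ K, f x = 0) (μ : Fin 4) : ∀ x ∉ K, pd μ f x = 0 := by
  intro x hx
  have : f =ᶠ[𝓝 x] fun _ => 0 :=
    Filter.mem_of_superset (hK.isOpen_compl.mem_nhds hx) fun y hy => hf y hy
  rw [pd, this.fderiv_eq]
  simp

/-- Integration by parts against a radial cutoff which vanishes near the axis. -/
theorem integral_cutoff_mul_divergence {F : Fin 4 → Coord → ℝ} {K : Set Coord} (hK : IsCompact K)
    (hF : ∀ μ, ContDiffOn ℝ 1 (F μ) {x | 0 < radius x}) (hFK : ∀ μ, ∀ x ∉ K, F μ x = 0)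
    {χ : ℝ → ℝ} (hχ : ContDiff ℝ 1 χ) {a : ℝ} (ha : 0 < a) (hχa : ∀ r ≤ a, χ r = 0) :
    ∫ x, χ (radius x) * ∑ μ, pd μ (F μ) x =
      -∫ x, deriv χ (radius x) / radius x * ∑ μ, spatial x μ * F μ x := by
  -- Strictness provides a neighbourhood of `r` on which `χ` vanishes.
  have hχ' : ∀ r < a, deriv χ r = 0 := fun r hr => by
    have : χ =ᶠ[𝓝 r] fun _ => 0 :=
      Filter.mem_of_superset (Iio_mem_nhds hr) fun s hs => hχa s (le_of_lt hs)
    rw [this.deriv_eq]; simp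
  have hs : ∀ μ, Continuous fun x : Coord => spatial x μ := fun μ => by
    fin_cases μ <;> simp [spatial] <;> fun_prop
  have hr : ContinuousOn radius {x | 0 < radius x} := continuous_radius.continuousOn
  have hχc : Continuous χ := hχ.continuous
  have hχd : Continuous (deriv χ) := hχ.continuous_deriv (by norm_num)
  have hcs : ∀ {f : Coord → ℝ}, (∀ x ∉ K, f x = 0) → HasCompactSupport f := fun hf =>
    HasCompactSupport.intro hK hf
  have hA : ∀ μ, Integrable fun x => χ (radius x) * pd μ (F μ) x := fun μ => by
    refine (continuous_of_continuousOn_off_axis ha ?_ fun x hx => ?_).integrable_of_hasCompactSupport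
      (hcs fun x hx => ?_)
    · exact (hχc.comp continuous_radius).continuousOn.mul (continuousOn_pd (hF μ) μ)
    · rw [hχa _ hx.le, zero_mul]
    · rw [pd_eq_zero_of_notMem hK.isClosed (hFK μ) μ x hx, mul_zero]
  have hB : ∀ μ, Integrable fun x => deriv χ (radius x) / radius x * (spatial x μ * F μ x) :=
    fun μ => by
    refine (continuous_of_continuousOn_off_axis ha ?_ fun x hx => ?_).integrable_of_hasCompactSupport
      (hcs fun x hx => ?_)
    · exact ((hχd.comp continuous_radius).continuousOn.div hr fun x hx => ne_of_gt hx).mul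
        ((hs μ).continuousOn.mul (hF μ).continuousOn)
    · rw [hχ' _ hx, zero_div, zero_mul]
    · rw [hFK μ x hx]; simp
  have key : ∀ μ, ∫ x, χ (radius x) * pd μ (F μ) x =
      -∫ x, deriv χ (radius x) / radius x * (spatial x μ * F μ x) := fun μ => by
    -- The cutoff removes the possible singularity of `F` on a full neighbourhood of the axis, so
    -- the product is `C¹` on all of space.
    have hf : ContDiff ℝ 1 fun x => χ (radius x) * F μ x := by
      rw [contDiff_iff_contDiffAt]
      intro x
      by_cases hx : 0 < radius x
      · exact (hχ.contDiffAt.comp x (contDiffAt_radius hx)).mul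
          ((hF μ).contDiffAt (isOpen_radius_pos.mem_nhds hx))
      · refine contDiffAt_const (c := (0 : ℝ)).congr_of_eventuallyEq ?_
        filter_upwards [(isOpen_lt continuous_radius continuous_const).mem_nhds
          (show radius x < a by linarith)] with y hy
        rw [hχa _ (le_of_lt hy), zero_mul]
    have h0 := integral_pd_eq_zero hf (hcs fun x hx => by rw [hFK μ x hx, mul_zero]) μ
    rw [← add_eq_zero_iff_eq_neg, ← integral_add (hA μ) (hB μ), ← h0]
    congr 1
    funext x
    by_cases hx : 0 < radius x
    · have := ((HasPartials.radial hx (hχ.contDiffAt.differentiableAt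
        (by norm_num)).hasDerivAt).mul (g := F μ) (w := fun κ => pd κ (F μ) x)
        ⟨((hF μ).contDiffAt (isOpen_radius_pos.mem_nhds hx)).differentiableAt (by norm_num),
          fun _ => rfl⟩).2 μ
      rw [this]
      ring
    · have hx0 : radius x < a := by linarith
      have : (fun x => χ (radius x) * F μ x) =ᶠ[𝓝 x] fun _ => 0 := by
        filter_upwards [(isOpen_lt continuous_radius continuous_const).mem_nhds hx0] with y hy
        rw [hχa _ (le_of_lt hy), zero_mul]
      rw [hχa _ hx0.le, hχ' _ hx0]
      simp only [pd]
      rw [this.fderiv_eq]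
      simp
  simp only [Finset.mul_sum]
  rw [integral_finsetSum _ fun μ _ => hA μ, integral_finsetSum _ fun μ _ => hB μ,
    ← Finset.sum_neg_distrib]
  exact Finset.sum_congr rfl fun μ _ => key μ

/-! ### Volumes of shells and cancellation by reflection -/

/-- The solid cylinder of radius `b` around the time axis, of height `2 T`. -/
def cylinder (T b : ℝ) : Set Coord := {x | |x 0| ≤ T ∧ radius x ≤ b}

theorem measurableSet_cylinder (T b : ℝ) : MeasurableSet (cylinder T b) :=
  (measurableSet_le (f := fun x : Coord => |x 0|) (by fun_prop) measurable_const).inter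
    (measurableSet_le continuous_radius.measurable measurable_const)

theorem abs_le_radius (x : Coord) {i : Fin 4} (hi : i ≠ 0) : |x i| ≤ radius x := by
  refine Real.abs_le_sqrt ?_
  fin_cases i
  · simp at hi
  all_goals simp; nlinarith [sq_nonneg (x 1), sq_nonneg (x 2), sq_nonneg (x 3)]

theorem volume_cylinder_one_lt_top (T : ℝ) : volume (cylinder T 1) < ⊤ := by
  refine (Metric.isBounded_closedBall (x := (0 : Coord)) (r := max T 1)).subset ?_ |>.measure_lt_top
  intro x hx
  rw [mem_closedBall_zero_iff, pi_norm_le_iff_of_nonneg (by positivity)]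
  intro i
  by_cases hi : i = 0
  · subst hi; exact hx.1.trans (le_max_left _ _)
  · exact (abs_le_radius x hi).trans (hx.2.trans (le_max_right _ _))

/-- Dilating the three spatial coordinates by `b` maps `cylinder T 1` to `cylinder T b` and has
determinant `b³`. -/
theorem volume_cylinder (T : ℝ) {b : ℝ} (hb : 0 < b) :
    volume (cylinder T b) = ENNReal.ofReal (b ^ 3) * volume (cylinder T 1) := by
  let d : Fin 4 → ℝ := ![1, b, b, b]
  let f : Coord →ₗ[ℝ] Coord := Matrix.toLin' (Matrix.diagonal d)
  have hf : ∀ x i, f x i = d i * x i := fun x i => by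
    simp [f, Matrix.toLin'_apply, Matrix.mulVec_diagonal]
  have hdet : LinearMap.det f = b ^ 3 := by
    simp [f, LinearMap.det_toLin', Matrix.det_diagonal, Fin.prod_univ_four, d]; ring
  have hpre : f ⁻¹' cylinder T b = cylinder T 1 := by
    ext x
    have hr : radius (f x) = b * radius x := by
      rw [radius, radius, hf, hf, hf]
      simp only [d]
      rw [show (![1, b, b, b] 1 * x 1) ^ 2 + (![1, b, b, b] 2 * x 2) ^ 2
        + (![1, b, b, b] 3 * x 3) ^ 2 = b ^ 2 * (x 1 ^ 2 + x 2 ^ 2 + x 3 ^ 2) by simp; ring,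
        Real.sqrt_mul (by positivity), Real.sqrt_sq hb.le]
    simp only [cylinder, mem_preimage, mem_ofPred_eq, hr, hf]
    refine and_congr (by simp [d]) ?_
    constructor
    · intro h; nlinarith
    · intro h; nlinarith
  have h := Measure.addHaar_preimage_linearMap (volume : Measure Coord) (f := f)
    (by rw [hdet]; positivity) (cylinder T b)
  rw [hpre, hdet, abs_of_pos (by positivity)] at h
  rw [h, ← mul_assoc, ← ENNReal.ofReal_mul (by positivity), mul_inv_cancel₀ (by positivity)]
  simp

theorem volume_real_shell (T : ℝ) {a b : ℝ} (ha : 0 < a) (hab : a ≤ b) :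
    volume.real (cylinder T b \ cylinder T a) = (b ^ 3 - a ^ 3) * volume.real (cylinder T 1) := by
  have hb := ha.trans_le hab
  have hfin : volume (cylinder T a) ≠ ⊤ := by
    rw [volume_cylinder T ha]
    exact ENNReal.mul_ne_top ENNReal.ofReal_ne_top (volume_cylinder_one_lt_top T).ne
  have hfin' : volume (cylinder T b) ≠ ⊤ := by
    rw [volume_cylinder T hb]
    exact ENNReal.mul_ne_top ENNReal.ofReal_ne_top (volume_cylinder_one_lt_top T).ne
  have hsub : cylinder T a ⊆ cylinder T b := fun x hx => ⟨hx.1, hx.2.trans hab⟩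
  rw [measureReal_sdiff hsub (measurableSet_cylinder T a) hfin']
  simp only [Measure.real, volume_cylinder T ha, volume_cylinder T hb, ENNReal.toReal_mul,
    ENNReal.toReal_ofReal (pow_pos ha 3).le, ENNReal.toReal_ofReal (pow_pos hb 3).le]
  ring

/-- The reflection `(t, x) ↦ (t, -x)`. -/
def reflect (x : Coord) : Coord := ![x 0, -x 1, -x 2, -x 3]

theorem radius_reflect (x : Coord) : radius (reflect x) = radius x := by
  simp [radius, reflect]

theorem measurePreserving_reflect : MeasurePreserving reflect := by
  have h : MeasurePreserving (fun (x : Coord) i => (![id, Neg.neg, Neg.neg, Neg.neg] :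
      Fin 4 → ℝ → ℝ) i (x i)) := by
    refine volume_preserving_pi fun i => ?_
    fin_cases i
    · exact MeasurePreserving.id volume
    all_goals exact Measure.measurePreserving_neg volume
  convert h using 1
  funext x i
  fin_cases i <;> simp [reflect]

theorem integral_reflect (f : Coord → ℝ) : ∫ x, f (reflect x) = ∫ x, f x := by
  refine measurePreserving_reflect.integral_comp ?_ f
  have hinv : ∀ x, reflect (reflect x) = x := fun x => by
    funext i; fin_cases i <;> simp [reflect]
  have hm : Measurable reflect := measurePreserving_reflect.measurable
  exact (MeasurableEquiv.mk ⟨reflect, reflect, hinv, hinv⟩ hm hm).measurableEmbedding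

/-- The average of `x · ψ` against a radial weight supported in a thin shell is small, because
the constant part of `ψ` cancels by reflection. -/
theorem abs_integral_shell_le {ψ : Coord → Coord} {L : NNReal} (hL : LipschitzWith L ψ) {T : ℝ}
    (hT : ∀ x, T < |x 0| → ψ x = 0) {h : ℝ → ℝ} {a b H : ℝ} (ha : 0 < a) (hab : a ≤ b)
    (hH : ∀ r, a < r → r ≤ b → |h r| ≤ H) (h0 : ∀ r, r ≤ a ∨ b < r → h r = 0)
    (hint : Integrable fun x => h (radius x) * ∑ μ, spatial x μ * ψ x μ) :
    |∫ x, h (radius x) * ∑ μ, spatial x μ * ψ x μ| ≤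
      3 * H * L * b ^ 2 * ((b ^ 3 - a ^ 3) * volume.real (cylinder T 1)) := by
  set S : Set Coord := cylinder T b \ cylinder T a with hS
  set G : Coord → ℝ := fun x => h (radius x) * ∑ μ, spatial x μ * ψ x μ with hG
  have hb := ha.trans_le hab
  have hGr : Integrable fun x => G (reflect x) :=
    measurePreserving_reflect.integrable_comp_of_integrable hint
  -- Adding the reflected integral replaces `ψ(x)` by `ψ(x) - ψ(reflect x)` in the spatial pairing.
  -- Outside the shell either `h` vanishes or both points lie beyond the time support of `ψ`.
  have h2 : 2 * ∫ x, G x = ∫ x in S, (G x + G (reflect x)) := by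
    rw [two_mul]
    nth_rewrite 2 [← integral_reflect]
    rw [← integral_add hint hGr]
    refine (setIntegral_eq_integral_of_forall_compl_eq_zero fun x hx => ?_).symm
    by_cases hr : radius x ≤ a ∨ b < radius x
    · simp only [hG, radius_reflect, h0 _ hr]; ring
    · push Not at hr
      have ht : T < |x 0| := by
        by_contra hcon
        exact hx ⟨⟨not_lt.1 hcon, hr.2⟩, fun hxa => absurd hxa.2 (not_le.2 hr.1)⟩
      simp only [hG]
      rw [hT x ht, hT (reflect x) (by simpa [reflect] using ht)]
      simp
  have hvol : volume S < ⊤ := by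
    refine (measure_mono sdiff_subset).trans_lt ?_
    rw [volume_cylinder T hb]
    exact ENNReal.mul_lt_top ENNReal.ofReal_lt_top (volume_cylinder_one_lt_top T)
  -- Reflection moves a point by at most `2r` in the sup norm, so each of the three spatial terms is
  -- at most `2 L b²`; this gives the `6`, halved at the end.
  have hbd : ∀ x ∈ S, ‖G x + G (reflect x)‖ ≤ H * (6 * L * b ^ 2) := by
    intro x hx
    have hrb : radius x ≤ b := hx.1.2
    have hra : a < radius x := by
      by_contra hcon
      exact hx.2 ⟨hx.1.1, not_lt.1 hcon⟩
    have hHx := hH _ hra hrb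
    have hr0 := radius_nonneg x
    have hdist : ‖x - reflect x‖ ≤ 2 * radius x := by
      rw [pi_norm_le_iff_of_nonneg (by positivity)]
      intro i
      have e : ∀ y : ℝ, ‖y - -y‖ = 2 * |y| := fun y => by
        rw [sub_neg_eq_add, ← two_mul, Real.norm_eq_abs, abs_mul, abs_two]
      fin_cases i
      · simpa [reflect] using hr0
      all_goals
        simp only [Pi.sub_apply]
        refine (le_of_eq (e _)).trans ?_
        exact mul_le_mul_of_nonneg_left (abs_le_radius x (by decide)) (by norm_num)
    have hψ : ∀ i, |ψ x i - ψ (reflect x) i| ≤ 2 * L * radius x := fun i => by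
      have h1 := hL.norm_sub_le x (reflect x)
      have h2 := norm_le_pi_norm (ψ x - ψ (reflect x)) i
      rw [Pi.sub_apply, Real.norm_eq_abs] at h2
      have h3 := mul_le_mul_of_nonneg_left hdist L.coe_nonneg
      linarith
    have hsum : G x + G (reflect x) = h (radius x) *
        (x 1 * (ψ x 1 - ψ (reflect x) 1) + x 2 * (ψ x 2 - ψ (reflect x) 2)
          + x 3 * (ψ x 3 - ψ (reflect x) 3)) := by
      simp only [hG, radius_reflect, Fin.sum_univ_four]
      simp [spatial, reflect]
      ring
    have hterm : ∀ i : Fin 4, i ≠ 0 →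
        |x i * (ψ x i - ψ (reflect x) i)| ≤ 2 * L * b ^ 2 := fun i hi => by
      rw [abs_mul]
      calc |x i| * |ψ x i - ψ (reflect x) i| ≤ radius x * (2 * L * radius x) :=
            mul_le_mul (abs_le_radius x hi) (hψ i) (abs_nonneg _) hr0
        _ = 2 * L * radius x ^ 2 := by ring
        _ ≤ 2 * L * b ^ 2 := by gcongr
    rw [hsum, Real.norm_eq_abs, abs_mul]
    refine mul_le_mul hHx ?_ (abs_nonneg _) ((abs_nonneg _).trans hHx)
    have t1 := abs_add_le (x 1 * (ψ x 1 - ψ (reflect x) 1) + x 2 * (ψ x 2 - ψ (reflect x) 2))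
      (x 3 * (ψ x 3 - ψ (reflect x) 3))
    have t2 := abs_add_le (x 1 * (ψ x 1 - ψ (reflect x) 1)) (x 2 * (ψ x 2 - ψ (reflect x) 2))
    have e1 := hterm 1 (by decide)
    have e2 := hterm 2 (by decide)
    have e3 := hterm 3 (by decide)
    linarith
  have hfin := norm_setIntegral_le_of_norm_le_const hvol hbd
  rw [← h2, hS, volume_real_shell T ha hab, Real.norm_eq_abs, abs_mul, abs_two] at hfin
  linarith

/-! ### Radial cutoffs -/

theorem exists_bound_deriv_smoothTransition :
    ∃ S : ℝ, 0 ≤ S ∧ ∀ r, |deriv Real.smoothTransition r| ≤ S := by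
  have hc : Continuous (deriv Real.smoothTransition) :=
    (Real.smoothTransition.contDiff (n := 1)).continuous_deriv (by norm_num)
  have hs : HasCompactSupport (deriv Real.smoothTransition) := by
    refine HasCompactSupport.intro (isCompact_Icc (a := (0 : ℝ)) (b := 1)) fun r hr => ?_
    rw [mem_Icc, not_and_or, not_le, not_le] at hr
    rcases hr with hr | hr
    · have : Real.smoothTransition =ᶠ[𝓝 r] fun _ => 0 :=
        Filter.mem_of_superset (Iio_mem_nhds hr) fun s hs =>
          Real.smoothTransition.zero_of_nonpos (le_of_lt hs)
      rw [this.deriv_eq]; simp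
    · have : Real.smoothTransition =ᶠ[𝓝 r] fun _ => 1 :=
        Filter.mem_of_superset (Ioi_mem_nhds hr) fun s hs =>
          Real.smoothTransition.one_of_one_le (le_of_lt hs)
      rw [this.deriv_eq]; simp
  obtain ⟨S, hS⟩ := hc.bounded_above_of_compact_support hs
  exact ⟨S, (norm_nonneg _).trans (hS 0), hS⟩

/-- A smooth cutoff function which increases from `0` at `a` to `1` at `b`. -/
def cutoff (a b r : ℝ) : ℝ := Real.smoothTransition ((r - a) / (b - a))

section cutoff

variable {a b : ℝ}

theorem cutoff_nonneg (a b r : ℝ) : 0 ≤ cutoff a b r := Real.smoothTransition.nonneg _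

theorem cutoff_le_one (a b r : ℝ) : cutoff a b r ≤ 1 := Real.smoothTransition.le_one _

theorem cutoff_eq_zero (hab : a < b) {r : ℝ} (hr : r ≤ a) : cutoff a b r = 0 :=
  Real.smoothTransition.zero_of_nonpos
    (div_nonpos_of_nonpos_of_nonneg (by linarith) (by linarith))

theorem cutoff_eq_one (hab : a < b) {r : ℝ} (hr : b ≤ r) : cutoff a b r = 1 :=
  Real.smoothTransition.one_of_one_le ((one_le_div (by linarith)).2 (by linarith))

theorem contDiff_cutoff (a b : ℝ) : ContDiff ℝ 1 (cutoff a b) :=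
  Real.smoothTransition.contDiff.comp ((contDiff_id.sub contDiff_const).div_const _)

/-- At such points the cutoff attains its global minimum `0` or maximum `1`. The extremum argument
covers the endpoint `r = a`, where the cutoff is not locally constant. -/
theorem deriv_cutoff_eq_zero (hab : a < b) {r : ℝ} (hr : r ≤ a ∨ b < r) :
    deriv (cutoff a b) r = 0 := by
  rcases hr with hr | hr
  · refine IsLocalMin.deriv_eq_zero (.of_forall fun s => ?_)
    rw [cutoff_eq_zero hab hr]
    exact cutoff_nonneg a b s
  · refine IsLocalMax.deriv_eq_zero (.of_forall fun s => ?_)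
    rw [cutoff_eq_one hab hr.le]
    exact cutoff_le_one a b s

theorem abs_deriv_cutoff_le (hab : a < b) {S : ℝ}
    (hS : ∀ r, |deriv Real.smoothTransition r| ≤ S) (r : ℝ) :
    |deriv (cutoff a b) r| ≤ S / (b - a) := by
  have h1 : HasDerivAt (fun r : ℝ => (r - a) / (b - a)) (1 / (b - a)) r :=
    ((hasDerivAt_id r).sub_const a).div_const _
  have h2 := (((Real.smoothTransition.contDiff (n := 1)).differentiable (by norm_num)
    ((r - a) / (b - a))).hasDerivAt).comp r h1
  have h3 : deriv (cutoff a b) r = _ := h2.deriv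
  have hba : 0 < b - a := by linarith
  rw [h3, abs_mul, abs_of_pos (one_div_pos.2 hba), mul_one_div]
  gcongr
  exact hS _

end cutoff

theorem measurableSet_outerRegion (ε : ℝ) : MeasurableSet (outerRegion ε) :=
  measurableSet_le measurable_const continuous_radius.measurable

theorem integrableOn_outerRegion {g : Coord → ℝ} {K : Set Coord} (hK : IsCompact K)
    (hg : ContinuousOn g {x | 0 < radius x}) (hgK : ∀ x ∉ K, g x = 0) {ε : ℝ} (hε : 0 < ε) :
    IntegrableOn g (outerRegion ε) := by
  have hcl : IsClosed (outerRegion ε) := isClosed_le continuous_const continuous_radius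
  have hc : IsCompact (outerRegion ε ∩ K) := hK.inter_left hcl
  have h1 : IntegrableOn g (outerRegion ε ∩ K) :=
    (hg.mono fun x hx => lt_of_lt_of_le hε hx.1).integrableOn_compact hc
  exact h1.of_forall_sdiff_eq_zero (measurableSet_outerRegion ε) fun x hx =>
    hgK x fun hxK => hx.2 ⟨hx.1, hxK⟩

/-- Smooth cutoffs approximate the sharp restriction to `Ω_ε`. -/
theorem tendsto_integral_cutoff {g : Coord → ℝ} {ε : ℝ} (hε : 0 < ε)
    (hg : IntegrableOn g (outerRegion (ε / 2))) :
    Tendsto (fun n : ℕ => ∫ x, cutoff (ε * (1 - 1 / ((n : ℝ) + 2))) ε (radius x) * g x) atTop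
      (𝓝 (∫ x in outerRegion ε, g x)) := by
  -- The shift by `2` keeps the inner radius at least `ε / 2`, so every cutoff is supported in the
  -- region where `g` is known to be integrable.
  have hn : ∀ n : ℕ, ε * (1 - 1 / ((n : ℝ) + 2)) < ε ∧ ε / 2 ≤ ε * (1 - 1 / ((n : ℝ) + 2)) := by
    intro n
    have h1 : 0 < 1 / ((n : ℝ) + 2) := by positivity
    have h2 : 1 / ((n : ℝ) + 2) ≤ 1 / 2 :=
      one_div_le_one_div_of_le (by norm_num) (by linarith [n.cast_nonneg (α := ℝ)])
    constructor <;> nlinarith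
  rw [← integral_indicator (measurableSet_outerRegion ε)]
  have hind : ∀ n : ℕ, (fun x => cutoff (ε * (1 - 1 / ((n : ℝ) + 2))) ε (radius x) * g x) =
      fun x => cutoff (ε * (1 - 1 / ((n : ℝ) + 2))) ε (radius x)
        * (outerRegion (ε / 2)).indicator g x := by
    intro n
    funext x
    by_cases hx : x ∈ outerRegion (ε / 2)
    · rw [indicator_of_mem hx]
    · rw [indicator_of_notMem hx, cutoff_eq_zero (hn n).1, zero_mul, zero_mul]
      exact (not_le.1 hx).le.trans (hn n).2
  have hgi := (integrable_indicator_iff (measurableSet_outerRegion (ε / 2))).2 hg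
  refine tendsto_integral_of_dominated_convergence
    (fun x => ‖(outerRegion (ε / 2)).indicator g x‖) (fun n => ?_) hgi.norm (fun n => ?_) ?_
  · rw [hind]
    exact ((contDiff_cutoff _ _).continuous.comp continuous_radius).aestronglyMeasurable.mul
      hgi.aestronglyMeasurable
  · refine .of_forall fun x => ?_
    rw [congrFun (hind n) x, norm_mul, Real.norm_eq_abs, abs_of_nonneg (cutoff_nonneg _ _ _)]
    exact mul_le_of_le_one_left (norm_nonneg _) (cutoff_le_one _ _ _)
  · refine .of_forall fun x => ?_
    by_cases hx : ε ≤ radius x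
    · rw [indicator_of_mem (show x ∈ outerRegion ε from hx)]
      simp_rw [fun n => cutoff_eq_one (hn n).1 hx, one_mul]
      exact tendsto_const_nhds
    · rw [indicator_of_notMem (show x ∉ outerRegion ε from hx)]
      have hlim : Tendsto (fun n : ℕ => ε * (1 - 1 / ((n : ℝ) + 2))) atTop (𝓝 (ε * (1 - 0))) :=
        (tendsto_const_nhds.sub (tendsto_const_nhds.div_atTop
          (tendsto_atTop_add_const_right _ _ tendsto_natCast_atTop_atTop))).const_mul ε
      rw [sub_zero, mul_one] at hlim
      refine tendsto_const_nhds.congr' ?_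
      filter_upwards [hlim.eventually (lt_mem_nhds (not_le.1 hx))] with n h
      rw [cutoff_eq_zero (hn n).1 h.le, zero_mul]

/-! ### Vanishing of the flux through thin cylinders -/

theorem contDiff_spatial (μ : Fin 4) : ContDiff ℝ 1 fun x : Coord => spatial x μ := by
  fin_cases μ <;> simp [spatial] <;> fun_prop

theorem contDiffOn_comp_radius {f : ℝ → ℝ} (hf : ContDiffOn ℝ 1 f (Ioi 0)) :
    ContDiffOn ℝ 1 (fun x => f (radius x)) {x : Coord | 0 < radius x} :=
  hf.comp (fun _ hx => (contDiffAt_radius hx).contDiffWithinAt) fun _ hx => hx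

theorem contDiffOn_flux {a b p D : ℝ → ℝ} (ha : ContDiffOn ℝ 1 a (Ioi 0))
    (hb : ContDiffOn ℝ 1 b (Ioi 0)) (hp : ContDiffOn ℝ 1 p (Ioi 0)) (hD : ContDiffOn ℝ 1 D (Ioi 0))
    {ψ : Coord → Coord} (hψ : ContDiff ℝ 1 ψ) (μ : Fin 4) :
    ContDiffOn ℝ 1 (flux a b p D ψ μ) {x | 0 < radius x} := by
  unfold flux frameTensor
  refine (contDiffOn_comp_radius hD).mul (ContDiffOn.sum fun ν _ => ?_)
  exact ((((contDiffOn_comp_radius ha).mul contDiffOn_const).add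
    ((contDiffOn_comp_radius hb).mul contDiffOn_const)).add
    ((contDiffOn_comp_radius hp).mul ((contDiff_spatial μ).mul (contDiff_spatial ν)).contDiffOn)).mul
    (contDiff_pi.1 hψ ν).contDiffOn

/-- As `x` is an eigenvector with eigenvalue `b + p r²`, the flux through a cylinder sees only the
radial component of the tensor. -/
theorem sum_spatial_mul_flux (a b p D : ℝ → ℝ) (ψ : Coord → Coord) (x : Coord) :
    ∑ μ, spatial x μ * flux a b p D ψ μ x =
      D (radius x) * (b (radius x) + p (radius x) * radius x ^ 2) * ∑ μ, spatial x μ * ψ x μ := by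
  simp only [flux, frameTensor]
  rw [radius_sq]
  simp only [Fin.sum_univ_four]
  simp [spatial, timeDelta, spaceDelta]
  ring

/-- The divergence of the flux of a compactly supported field, integrated over `Ω_ε`, tends to
zero if the radial component of the tensor density is small. -/
theorem tendsto_integral_divergence_flux {a b p D : ℝ → ℝ} (ha : ContDiffOn ℝ 1 a (Ioi 0))
    (hb : ContDiffOn ℝ 1 b (Ioi 0)) (hp : ContDiffOn ℝ 1 p (Ioi 0)) (hD : ContDiffOn ℝ 1 D (Ioi 0))
    {ψ : Coord → Coord} (hψ : ContDiff ℝ 1 ψ) (hψc : HasCompactSupport ψ) {γ M δ : ℝ} (hγ : 0 < γ)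
    (hδ : 0 < δ)
    (hM : ∀ r, 0 < r → r < δ → |D r * (b r + p r * r ^ 2)| * r ^ 3 ≤ M * r ^ γ) :
    (∀ ε > 0, IntegrableOn (fun x => ∑ μ, pd μ (flux a b p D ψ μ) x) (outerRegion ε)) ∧
    Tendsto (fun ε => ∫ x in outerRegion ε, ∑ μ, pd μ (flux a b p D ψ μ) x) (𝓝[>] 0) (𝓝 0) := by
  have hF := contDiffOn_flux ha hb hp hD hψ
  have hK : IsCompact (tsupport ψ) := hψc
  have hψK : ∀ x ∉ tsupport ψ, ψ x = 0 := fun x hx => image_eq_zero_of_notMem_tsupport hx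
  have hFK : ∀ μ, ∀ x ∉ tsupport ψ, flux a b p D ψ μ x = 0 := fun μ x hx => by
    simp [flux, hψK x hx]
  have hint : ∀ ε > 0,
      IntegrableOn (fun x => ∑ μ, pd μ (flux a b p D ψ μ) x) (outerRegion ε) := fun ε hε =>
    integrableOn_outerRegion hK (continuousOn_finsetSum _ fun μ _ => continuousOn_pd (hF μ) μ)
      (fun x hx => Finset.sum_eq_zero fun μ _ =>
        pd_eq_zero_of_notMem hK.isClosed (hFK μ) μ x hx) hε
  refine ⟨hint, ?_⟩
  obtain ⟨L, hL⟩ := ContDiff.lipschitzWith_of_hasCompactSupport hψc hψ one_ne_zero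
  obtain ⟨T, hT⟩ := hK.isBounded.exists_norm_le
  have hT' : ∀ x : Coord, T < |x 0| → ψ x = 0 := fun x hx => by
    refine hψK x fun hxK => ?_
    have h1 := norm_le_pi_norm x 0
    rw [Real.norm_eq_abs] at h1
    linarith [hT x hxK]
  obtain ⟨S, hS0, hS⟩ := exists_bound_deriv_smoothTransition
  set V := volume.real (cylinder T 1) with hV
  have hV0 : 0 ≤ V := measureReal_nonneg
  -- Evaluating the bound at any point of `(0, δ)` shows `M ≥ 0`; `δ / 2` is one.
  have hM0 : 0 ≤ M := by
    have h := hM (δ / 2) (by positivity) (by linarith)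
    have h' : 0 ≤ |D (δ / 2) * (b (δ / 2) + p (δ / 2) * (δ / 2) ^ 2)| * (δ / 2) ^ 3 := by positivity
    exact nonneg_of_mul_nonneg_left (h'.trans h) (by positivity)
  -- The bound is proved for each cutoff, uniformly in `n`, and passes to the limit. The constant is
  -- `3 · 16 · 3`: from the shell estimate, from `r⁻⁴ ≤ 16 ε⁻⁴` on `r ≥ ε / 2`, and from `ε³ - e³ ≤
  -- 3 ε² (ε - e)`. The width `ε - e` cancels against the slope of the cutoff.
  have main : ∀ ε, 0 < ε → ε < δ →
      |∫ x in outerRegion ε, ∑ μ, pd μ (flux a b p D ψ μ) x| ≤ 144 * S * M * L * V * ε ^ γ := by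
    intro ε hε hεδ
    refine le_of_tendsto (tendsto_integral_cutoff hε (hint _ (by positivity))).abs
      (.of_forall fun n => ?_)
    set e := ε * (1 - 1 / ((n : ℝ) + 2)) with he
    have hn1 : 0 < 1 / ((n : ℝ) + 2) := by positivity
    have hn2 : 1 / ((n : ℝ) + 2) ≤ 1 / 2 :=
      one_div_le_one_div_of_le (by norm_num) (by linarith [n.cast_nonneg (α := ℝ)])
    have heε : e < ε := by rw [he]; nlinarith
    have he2 : ε / 2 ≤ e := by rw [he]; nlinarith
    have he0 : 0 < e := by linarith
    rw [integral_cutoff_mul_divergence hK hF hFK (contDiff_cutoff e ε) he0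
      (fun r hr => cutoff_eq_zero heε hr), abs_neg]
    simp only [sum_spatial_mul_flux, ← mul_assoc]
    have hχd : Continuous (deriv (cutoff e ε)) := (contDiff_cutoff e ε).continuous_deriv (by norm_num)
    have h0 : ∀ r, r ≤ e ∨ ε < r →
        deriv (cutoff e ε) r / r * D r * (b r + p r * r ^ 2) = 0 := fun r hr => by
      rw [deriv_cutoff_eq_zero heε hr]; simp
    have hi : Integrable fun x => deriv (cutoff e ε) (radius x) / radius x * D (radius x)
        * (b (radius x) + p (radius x) * radius x ^ 2) * ∑ μ, spatial x μ * ψ x μ := by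
      refine (continuous_of_continuousOn_off_axis he0 ?_ fun x hx => ?_
        ).integrable_of_hasCompactSupport (HasCompactSupport.intro hK fun x hx => ?_)
      · have hr : ContinuousOn radius {x | 0 < radius x} := continuous_radius.continuousOn
        refine ((((hχd.comp continuous_radius).continuousOn.div hr fun x hx => ne_of_gt hx).mul
          (contDiffOn_comp_radius hD).continuousOn).mul
          ((contDiffOn_comp_radius hb).continuousOn.add
            ((contDiffOn_comp_radius hp).continuousOn.mul (hr.pow 2)))).mul ?_
        exact (continuous_finsetSum _ fun μ _ => (contDiff_spatial μ).continuous.mul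
          (contDiff_pi.1 hψ μ).continuous).continuousOn
      · rw [h0 _ (Or.inl hx.le), zero_mul]
      · simp [hψK x hx]
    have hH : ∀ r, e < r → r ≤ ε → |deriv (cutoff e ε) r / r * D r * (b r + p r * r ^ 2)| ≤
        S / (ε - e) * (16 / ε ^ 4 * (M * ε ^ γ)) := by
      intro r hr hrε
      have hr0 : 0 < r := he0.trans hr
      -- One factor `1 / r` comes from the gradient of the cutoff, the other three compensate the
      -- `r³` in the hypothesis `hM`.
      have e1 : deriv (cutoff e ε) r / r * D r * (b r + p r * r ^ 2) =
          deriv (cutoff e ε) r * (1 / r ^ 4 * (D r * (b r + p r * r ^ 2) * r ^ 3)) := by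
        field_simp
      rw [e1, abs_mul, abs_mul, abs_mul (D r * _), abs_of_pos (pow_pos hr0 3),
        abs_of_pos (one_div_pos.2 (pow_pos hr0 4))]
      have h4 : 1 / r ^ 4 ≤ 16 / ε ^ 4 := by
        have : (ε / 2) ^ 4 ≤ r ^ 4 := by gcongr; linarith
        rw [div_le_div_iff₀ (by positivity) (by positivity)]
        nlinarith
      have h5 : |D r * (b r + p r * r ^ 2)| * r ^ 3 ≤ M * ε ^ γ :=
        (hM r hr0 (by linarith)).trans (mul_le_mul_of_nonneg_left
          (Real.rpow_le_rpow hr0.le hrε hγ.le) hM0)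
      have hεe : 0 < ε - e := by linarith
      exact mul_le_mul (abs_deriv_cutoff_le heε hS r)
        (mul_le_mul h4 h5 (by positivity) (by positivity)) (by positivity) (by positivity)
    have := abs_integral_shell_le hL hT' he0 heε.le hH h0 hi
    refine this.trans ?_
    rw [← hV]
    have hεe : 0 < ε - e := by linarith
    -- The difference of the two sides is `(ε - e)² (2 ε + e)`.
    have hcube : ε ^ 3 - e ^ 3 ≤ 3 * ε ^ 2 * (ε - e) := by
      nlinarith [mul_nonneg hεe.le (mul_nonneg hεe.le (by linarith : 0 ≤ 2 * ε + e))]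
    calc 3 * (S / (ε - e) * (16 / ε ^ 4 * (M * ε ^ γ))) * L * ε ^ 2 * ((ε ^ 3 - e ^ 3) * V)
        ≤ 3 * (S / (ε - e) * (16 / ε ^ 4 * (M * ε ^ γ))) * L * ε ^ 2
          * ((3 * ε ^ 2 * (ε - e)) * V) := by gcongr
      _ = 144 * S * M * L * V * ε ^ γ := by field_simp; ring
  have hlim : Tendsto (fun ε : ℝ => 144 * S * M * L * V * ε ^ γ) (𝓝[>] 0) (𝓝 0) := by
    have h := ((Real.continuousAt_rpow_const 0 γ (Or.inr hγ.le)).tendsto.const_mul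
      (144 * S * M * L * V)).mono_left (nhdsWithin_le_nhds (s := Ioi 0))
    rwa [Real.zero_rpow hγ.ne', mul_zero] at h
  refine squeeze_zero_norm' ?_ hlim
  filter_upwards [Ioo_mem_nhdsGT hδ] with ε hε using main ε hε.1 hε.2

/-! ### The weak Bianchi identity -/

/-- The axis lies in the null hyperplane `x¹ = 0`, and any point off the axis belongs to `Ω_ε` once
`ε` is at most its radius. -/
theorem aecover_outerRegion : AECover (volume : Measure Coord) (𝓝[>] (0 : ℝ)) outerRegion := by
  refine ⟨?_, measurableSet_outerRegion⟩
  have h0 : ∀ᵐ x : Coord, x 1 ≠ 0 := by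
    rw [ae_iff]
    simpa [volume_pi] using Measure.pi_hyperplane (fun _ : Fin 4 => (volume : Measure ℝ)) 1 0
  filter_upwards [h0] with x hx
  have hpos : 0 < radius x := (abs_pos.2 hx).trans_le (abs_le_radius x (by decide))
  filter_upwards [Ioo_mem_nhdsGT hpos] with ε hε using hε.2.le

theorem bianchiIntegrand_eq {c : ℝ} (hc : 0 < c) {α β : ℝ → ℝ}
    (hα : ContDiffOn ℝ 3 α (Ioi 0)) (hβ : ContDiffOn ℝ 3 β (Ioi 0)) {ψ : Coord → Coord}
    (hψ : ContDiff ℝ 1 ψ) {x : Coord} (hx : 0 < radius x) :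
    bianchiIntegrand c α β ψ x = ∑ μ, pd μ (flux (einsteinTT β) (einsteinAngular α β)
      (einsteinShear α β) (fun r => c * Real.exp (α r + β r)) ψ μ) x := by
  have dα : DifferentiableAt ℝ α (radius x) :=
    (hα.differentiableOn (by norm_num)).differentiableAt (Ioi_mem_nhds hx)
  have dβ : DifferentiableAt ℝ β (radius x) :=
    (hβ.differentiableOn (by norm_num)).differentiableAt (Ioi_mem_nhds hx)
  have ddα : DifferentiableAt ℝ (deriv α) (radius x) :=
    ((hα.deriv_of_isOpen (m := 2) isOpen_Ioi (by norm_num)).differentiableOn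
      (by norm_num)).differentiableAt (Ioi_mem_nhds hx)
  obtain ⟨hA, -, hC⟩ := contDiffOn_einstein hα hβ
  have hA' := ((hA.differentiableOn one_ne_zero).differentiableAt (Ioi_mem_nhds hx)).hasDerivAt
  have hC' := ((hC.differentiableOn one_ne_zero).differentiableAt (Ioi_mem_nhds hx)).hasDerivAt
  have hS' : HasDerivAt (einsteinShear α β) _ (radius x) :=
    ((hasDerivAt_einsteinRR hx dβ ddα).sub hC').div (hasDerivAt_pow 2 (radius x)) (by positivity)
  have hD' : HasDerivAt (fun r => c * Real.exp (α r + β r)) _ (radius x) :=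
    ((dα.hasDerivAt.add dβ.hasDerivAt).exp).const_mul c
  rw [divergence_flux (P := coeffP β) (Q := coeffQ β) (U := coeffU α) (V := coeffV c α β)
    hx hA' hC' hS' hD' (hψ.contDiffAt.differentiableAt one_ne_zero)]
  · simp only [bianchiIntegrand, volDensity_cartesianMetric hc α β hx,
      einstein_cartesianMetric hc hα hβ hx, covDeriv,
      christoffel_cartesianMetric hc hx dα dβ, einsteinShear]
  -- What remains is the vanishing of the radial divergence. With `G^r_r` replaced through
  -- `hasDerivAt_einsteinRR`, the derivative `C'` of the angular component cancels between `b'` and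
  -- `p'`, and `β'` cancels between the density and the Christoffel trace.
  · simp only [einsteinShear, coeffP, coeffQ, coeffU, Pi.add_apply, Pi.sub_apply]
    generalize einsteinTT β (radius x) = A
    generalize einsteinRR α β (radius x) = B
    generalize deriv (einsteinAngular α β) (radius x) = C'
    generalize einsteinAngular α β (radius x) = C
    field_simp
    push_cast
    ring

theorem weakBianchi_of_bound {c : ℝ} (hc : 0 < c) {α β : ℝ → ℝ}
    (hα : ContDiffOn ℝ 3 α (Ioi 0)) (hβ : ContDiffOn ℝ 3 β (Ioi 0)) {γ M δ : ℝ} (hγ : 0 < γ)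
    (hδ : 0 < δ) (hM : ∀ r, 0 < r → r < δ →
      |c * Real.exp (α r + β r) * einsteinRR α β r| * r ^ 3 ≤ M * r ^ γ) :
    WeakBianchi c α β := by
  intro ψ hψ hψc
  have hψ1 : ContDiff ℝ 1 ψ := hψ.of_le (by exact_mod_cast le_top)
  obtain ⟨hA, hB, hC⟩ := contDiffOn_einstein hα hβ
  have hS : ContDiffOn ℝ 1 (einsteinShear α β) (Ioi 0) :=
    (hB.sub hC).div (by fun_prop) fun r hr => pow_ne_zero 2 (ne_of_gt hr)
  have hα0 := hα.of_le (m := 1) (by norm_num)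
  have hβ0 := hβ.of_le (m := 1) (by norm_num)
  have hD : ContDiffOn ℝ 1 (fun r => c * Real.exp (α r + β r)) (Ioi 0) := by fun_prop
  obtain ⟨h1, h2⟩ := tendsto_integral_divergence_flux hA hC hS hD hψ1 hψc hγ hδ (M := M)
    fun r hr hrδ => by
      have e : einsteinAngular α β r + einsteinShear α β r * r ^ 2 = einsteinRR α β r := by
        unfold einsteinShear; field_simp; ring
      rw [e]
      exact hM r hr hrδ
  have heq : ∀ ε > 0, EqOn (bianchiIntegrand c α β ψ) (fun x => ∑ μ, pd μ (flux (einsteinTT β)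
      (einsteinAngular α β) (einsteinShear α β) (fun r => c * Real.exp (α r + β r)) ψ μ) x)
      (outerRegion ε) := fun ε hε x hx =>
    bianchiIntegrand_eq hc hα hβ hψ1 (lt_of_lt_of_le hε hx)
  have h3 : Tendsto (fun ε => ∫ x in outerRegion ε, bianchiIntegrand c α β ψ x) (𝓝[>] 0)
      (𝓝 0) := by
    refine h2.congr' ?_
    filter_upwards [self_mem_nhdsWithin] with ε hε
    exact (setIntegral_congr_fun (measurableSet_outerRegion ε) (heq ε hε)).symm
  refine ⟨fun ε hε => (h1 ε hε).congr_fun (heq ε hε).symm (measurableSet_outerRegion ε), h3,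
    fun hi => ?_⟩
  -- For an integrable integrand, the integrals over `Ω_ε` converge to the Lebesgue integral as well
  -- as to zero.
  exact tendsto_nhds_unique (aecover_outerRegion.integral_tendsto_of_countably_generated hi) h3

/-! ### Decay conditions in terms of `α` and `β` -/

theorem einsteinTT_weighted (α β : ℝ → ℝ) {r : ℝ} (hr : 0 < r) :
    r ^ 3 * einsteinTT β r * Real.exp (α r + β r) =
      r * Real.exp (α r - β r) * (1 - Real.exp (2 * β r) - 2 * r * deriv β r) := by
  have h : Real.exp (α r - β r) = Real.exp (-(2 * β r)) * Real.exp (α r + β r) := by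
    rw [← Real.exp_add]; ring_nf
  rw [einsteinTT, h]
  field_simp

theorem einsteinRR_weighted (α β : ℝ → ℝ) {r : ℝ} (hr : 0 < r) :
    r ^ 3 * einsteinRR α β r * Real.exp (α r + β r) =
      r * Real.exp (α r - β r) * (1 - Real.exp (2 * β r) + 2 * r * deriv α r) := by
  have h : Real.exp (α r - β r) = Real.exp (-(2 * β r)) * Real.exp (α r + β r) := by
    rw [← Real.exp_add]; ring_nf
  rw [einsteinRR, h]
  field_simp

theorem einsteinAngular_weighted (α β : ℝ → ℝ) {r : ℝ} (hr : 0 < r) :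
    r ^ 3 * einsteinAngular α β r * Real.exp (α r + β r) =
      r ^ 2 * Real.exp (α r - β r) *
        ((1 + r * deriv α r) * (deriv α r - deriv β r) + r * deriv (deriv α) r) := by
  have h : Real.exp (α r - β r) = Real.exp (-(2 * β r)) * Real.exp (α r + β r) := by
    rw [← Real.exp_add]; ring_nf
  rw [einsteinAngular, h]
  field_simp

/-- After weighting, the left side is `|f| + |g| + |h|` for the three explicit functions. A sum of
nonnegative terms is `O(r^γ)` exactly when each term is. -/
theorem einsteinDecay_iff {c : ℝ} (hc : 0 < c) {α β : ℝ → ℝ}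
    (hα : ContDiffOn ℝ 3 α (Ioi 0)) (hβ : ContDiffOn ℝ 3 β (Ioi 0)) (γ : ℝ) :
    EinsteinDecay c α β γ ↔ DecayTT α β γ ∧ DecayRR α β γ ∧ DecayThetaTheta α β γ := by
  unfold EinsteinDecay DecayTT DecayRR DecayThetaTheta
  set f := fun r : ℝ => r * Real.exp (α r - β r) * (1 - Real.exp (2 * β r) - 2 * r * deriv β r)
    with hf
  set g := fun r : ℝ => r * Real.exp (α r - β r) * (1 - Real.exp (2 * β r) + 2 * r * deriv α r)
    with hg
  set h := fun r : ℝ => r ^ 2 * Real.exp (α r - β r) *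
    ((1 + r * deriv α r) * (deriv α r - deriv β r) + r * deriv (deriv α) r) with hh
  have key : (fun r : ℝ => r ^ 3 * (|sphericalEinstein c α β 0 0 r| + |sphericalEinstein c α β 1 1 r|
    + |sphericalEinstein c α β 2 2 r|) * Real.exp (α r + β r)) =ᶠ[𝓝[>] 0]
      fun r => |f r| + |g r| + |h r| := by
    filter_upwards [self_mem_nhdsWithin] with r hr
    have hr : 0 < r := hr
    obtain ⟨e0, e1, e2⟩ := sphericalEinstein_eq hc hα hβ hr
    simp only [hf, hg, hh]
    rw [e0, e1, e2, ← einsteinTT_weighted α β hr, ← einsteinRR_weighted α β hr,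
      ← einsteinAngular_weighted α β hr]
    simp only [abs_mul, abs_of_pos (pow_pos hr 3), Real.abs_exp]
    ring
  rw [Asymptotics.isBigO_congr key .rfl]
  constructor
  · intro H
    refine ⟨?_, ?_, ?_⟩ <;> refine (Asymptotics.isBigO_of_le _ fun r => ?_).trans H <;>
      rw [Real.norm_eq_abs, Real.norm_eq_abs,
        abs_of_nonneg (by positivity : 0 ≤ |f r| + |g r| + |h r|)] <;>
      linarith [abs_nonneg (f r), abs_nonneg (g r), abs_nonneg (h r)]
  · rintro ⟨h1, h2, h3⟩
    exact (h1.norm_left.add h2.norm_left).add h3.norm_left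

/-- The boundary flux involves `G^r_r` alone, and the decay of its weighted form is exactly the
bound required by `weakBianchi_of_bound`, up to the factor `c`. -/
theorem weakBianchi_of_decayRR {c : ℝ} (hc : 0 < c) {α β : ℝ → ℝ}
    (hα : ContDiffOn ℝ 3 α (Ioi 0)) (hβ : ContDiffOn ℝ 3 β (Ioi 0)) {γ : ℝ} (hγ : 0 < γ)
    (h : DecayRR α β γ) : WeakBianchi c α β := by
  obtain ⟨M, hM⟩ := h.bound
  obtain ⟨δ, hδ, hb⟩ := mem_nhdsGT_iff_exists_Ioo_subset.1 hM
  refine weakBianchi_of_bound hc hα hβ hγ hδ (M := c * M) fun r hr hrδ => ?_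
  have h1 : ‖_‖ ≤ M * ‖r ^ γ‖ := hb ⟨hr, hrδ⟩
  rw [← einsteinRR_weighted α β hr, Real.norm_eq_abs, Real.norm_eq_abs,
    abs_of_pos (Real.rpow_pos_of_pos hr γ)] at h1
  have e : |c * Real.exp (α r + β r) * einsteinRR α β r| * r ^ 3 =
      c * |r ^ 3 * einsteinRR α β r * Real.exp (α r + β r)| := by
    simp only [abs_mul, abs_of_pos (pow_pos hr 3), Real.abs_exp, abs_of_pos hc]
    ring
  rw [e, mul_assoc c M]
  exact mul_le_mul_of_nonneg_left h1 hc.le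

/-- Monotonicity bounds the norm on `(0, ε]` by `e^{α(ε)+β(ε)}`, so the product is at most the
weighted `G^r_r` at `ε`, which is `O(ε^γ)`. -/
theorem radialLimit_of_monotoneOn {c : ℝ} (hc : 0 < c) {α β : ℝ → ℝ}
    (hα : ContDiffOn ℝ 3 α (Ioi 0)) (hβ : ContDiffOn ℝ 3 β (Ioi 0)) {γ : ℝ} (hγ : 0 < γ)
    (h : DecayRR α β γ) {δ : ℝ} (hδ : 0 < δ)
    (hmono : MonotoneOn (fun r => α r + β r) (Ioc 0 δ)) : RadialLimit c α β := by
  have hlim : Tendsto (fun r : ℝ => r ^ γ) (𝓝[>] 0) (𝓝 0) := by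
    have h := (Real.continuousAt_rpow_const 0 γ (Or.inr hγ.le)).tendsto.mono_left
      (nhdsWithin_le_nhds (s := Ioi 0))
    rwa [Real.zero_rpow hγ.ne'] at h
  have h0 := (ENNReal.tendsto_ofReal (h.trans_tendsto hlim).abs)
  rw [abs_zero, ENNReal.ofReal_zero] at h0
  refine tendsto_of_tendsto_of_tendsto_of_le_of_le' tendsto_const_nhds h0
    (.of_forall fun _ => zero_le) ?_
  filter_upwards [Ioo_mem_nhdsGT hδ] with ε hε
  have hnorm : eLpNorm (fun r => Real.exp (α r + β r)) ⊤ (volume.restrict (Ioc 0 ε)) ≤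
      ENNReal.ofReal (Real.exp (α ε + β ε)) := by
    rw [eLpNorm_exponent_top]
    refine eLpNormEssSup_le_of_ae_bound ?_
    filter_upwards [ae_restrict_mem measurableSet_Ioc] with r hr
    rw [Real.norm_eq_abs, Real.abs_exp, Real.exp_le_exp]
    exact hmono ⟨hr.1, hr.2.trans hε.2.le⟩ ⟨hε.1, hε.2.le⟩ hr.2
  refine (mul_le_mul_right hnorm _).trans (le_of_eq ?_)
  rw [← ENNReal.ofReal_mul (abs_nonneg _), ← einsteinRR_weighted α β hε.1,
    (sphericalEinstein_eq hc hα hβ hε.1).2.1, abs_mul _ (Real.exp _), Real.abs_exp]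

end StaticBianchi

end

theorem corollary2p2 (c : ℝ) (hc : 0 < c) (α β : ℝ → ℝ)
    (hα : ContDiffOn ℝ 3 α (Set.Ioi 0)) (hβ : ContDiffOn ℝ 3 β (Set.Ioi 0)) :
    -- decay of the Einstein tensor gives the weak Bianchi identity
    ((∃ γ : ℝ, 0 < γ ∧ StaticBianchi.EinsteinDecay c α β γ) →
      StaticBianchi.RadialLimit c α β → StaticBianchi.WeakBianchi c α β) ∧
    -- the decay of the Einstein tensor in terms of `α` and `β`
    (∀ γ : ℝ, 0 < γ → (StaticBianchi.EinsteinDecay c α β γ ↔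
      (StaticBianchi.DecayTT α β γ ∧ StaticBianchi.DecayRR α β γ ∧
        StaticBianchi.DecayThetaTheta α β γ))) ∧
    ((∃ γ : ℝ, 0 < γ ∧ StaticBianchi.DecayTT α β γ ∧ StaticBianchi.DecayRR α β γ ∧
        StaticBianchi.DecayThetaTheta α β γ) →
      StaticBianchi.RadialLimit c α β → StaticBianchi.WeakBianchi c α β) ∧
    -- if `α + β` decreases as `r ↓ 0`, the limit condition is automatic
    (∀ γ : ℝ, 0 < γ → StaticBianchi.DecayRR α β γ →
      (∃ δ : ℝ, 0 < δ ∧ MonotoneOn (fun r => α r + β r) (Set.Ioc 0 δ)) →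
      StaticBianchi.RadialLimit c α β) := by
  refine ⟨?_, fun γ _ => StaticBianchi.einsteinDecay_iff hc hα hβ γ, ?_, ?_⟩
  · rintro ⟨γ, hγ, h⟩ -
    exact StaticBianchi.weakBianchi_of_decayRR hc hα hβ hγ
      ((StaticBianchi.einsteinDecay_iff hc hα hβ γ).1 h).2.1
  · rintro ⟨γ, hγ, -, h, -⟩ -
    exact StaticBianchi.weakBianchi_of_decayRR hc hα hβ hγ h
  · rintro γ hγ h ⟨δ, hδ, hmono⟩
    exact StaticBianchi.radialLimit_of_monotoneOn hc hα hβ hγ h hδ hmono
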